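/- Theorem (Uniqueness). Let $n\ge 2$ and write $x=(x',x_n)\in\mathbb R^{n-1}\times\mathbb R$. *The gas.* Let $p$ be a smooth function on $(0,\infty)$ with $p'>0$ and $p''>0$, let $h(r)=\int_1^r \frac{p'(s)}{s}\,ds$, and let $\rho=\rho(q^2)$ be the density-speed relation determined by Bernoulli's law $\tfrac12 q^2+h(\rho)=B$ with a constant $B$. Let $q_{cr}>0$ be the critical speed, i.e. the speed with $q_{cr}^2=p'(\rho(q_{cr}^2))$ (after nondimensionalization, $q_{cr}=1$ and $\rho(1)=1$). *The nozzle.* Let $\Omega\subset\mathbb R^n$ be open and let $\mathcal C=B(0,1)\times\mathbb R$ be the unit cylinder, where $B(0,1)$ is the open unit ball of $\mathbb R^{n-1}$. Suppose that there are $\alpha\in(0,1)$, a constant $K$ and an invertible $C^{2,\alpha}$ map $T:\overline\Omega\to\overline{\mathcal C}$ such that $T(\partial\Omega)=\partial\mathcal C$, $T(\Omega\cap\{x_n=k\})=B(0,1)\times\{y_n=k\}$ for every $k\in\mathbb R$, and, for both $T$ and $T^{-1}$, the first and second derivatives and the $\alpha$-Hölder seminorm of the second derivative are bounded by $K$. *The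 flows.* Let $\varphi_1,\varphi_2\in C^2(\Omega)$, with gradients that extend continuously to $\overline\Omega$, be two solutions of $$\operatorname{div}\big(\rho(|\nabla\varphi_k|^2)\nabla\varphi_k\big)=0\ \text{ in }\Omega,\qquad \frac{\partial\varphi_k}{\partial\vec n}=0\ \text{ on }\partial\Omega,$$ where $\vec n$ is the outer unit normal, which are uniformly subsonic, i.e. $\sup_{\Omega}|\nabla\varphi_k|<q_{cr}$ for $k=1,2$, and which carry the same mass flux $m_0\in\mathbb R$, i.e. $\int_{\Omega\cap\{x_n=t\}}\rho(|\nabla\varphi_k|^2)\,\partial_{x_n}\varphi_k\,dx'=m_0$ for every $t\in\mathbb R$ and $k=1,2$. Then $\nabla\varphi_1=\nabla\varphi_2$ in $\Omega$. (No assumption is made on the asymptotic behaviour of $\Omega$ as $x_n\to\pm\infty$.) -/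

import Mathlib

open Set Filter Topology MeasureTheory
open scoped Gradient ContDiff

noncomputable section

/-! ### The gas -/

/-- An equation of state: the pressure `p` is a smooth function of the density `r > 0`
with `p' > 0` and `p'' > 0`. -/
structure IsEquationOfState (p : ℝ → ℝ) : Prop where
  smooth : ContDiffOn ℝ ∞ p (Ioi 0)
  deriv_pos : ∀ r, 0 < r → 0 < deriv p r
  deriv_deriv_pos : ∀ r, 0 < r → 0 < deriv (deriv p) r

/-- The enthalpy `h(r) = ∫_1^r p'(s)/s ds`. -/
def enthalpy (p : ℝ → ℝ) (r : ℝ) : ℝ := ∫ s in (1 : ℝ)..r, deriv p s / s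

/-- The local sound speed `c(r) = √(p'(r))`. -/
def soundSpeed (p : ℝ → ℝ) (r : ℝ) : ℝ := Real.sqrt (deriv p r)

/-- The density-speed relation `t = q² ↦ ρ(q²)`: the density `r > 0` determined by
Bernoulli's law `q²/2 + h(r) = B`. -/
def density (p : ℝ → ℝ) (B : ℝ) (t : ℝ) : ℝ :=
  Function.invFunOn (enthalpy p) (Ioi 0) (B - t / 2)

/-- `q` is the critical speed of the gas with Bernoulli constant `B`: a state of density `r`
and speed `q` satisfies Bernoulli's law, and there the speed equals the speed of sound. -/
def IsCriticalSpeed (p : ℝ → ℝ) (B q : ℝ) : Prop :=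
  0 < q ∧ ∃ r, 0 < r ∧ q ^ 2 / 2 + enthalpy p r = B ∧ q = soundSpeed p r

/-! ### The nozzle

The space dimension is `n = d + 1`; the last coordinate is the longitudinal one. -/

/-- Euclidean space of dimension `d + 1`. -/
abbrev Space (d : ℕ) : Type := EuclideanSpace ℝ (Fin (d + 1))

/-- The longitudinal coordinate. -/
def axial {d : ℕ} (x : Space d) : ℝ := x (Fin.last d)

/-- The remaining (transverse) coordinates. -/
def transverse {d : ℕ} (x : Space d) : EuclideanSpace ℝ (Fin d) :=
  WithLp.toLp 2 fun i => x i.castSucc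

/-- The point with transverse coordinates `z` and longitudinal coordinate `t`. -/
def sectionPoint {d : ℕ} (z : EuclideanSpace ℝ (Fin d)) (t : ℝ) : Space d :=
  WithLp.toLp 2 (Fin.snoc (α := fun _ => ℝ) (fun i => z i) t)

/-- The unit cylinder `B(0,1) × ℝ`. -/
def unitCylinder (d : ℕ) : Set (Space d) := {y | ‖transverse y‖ < 1}

/-- On the open set `U`, the map `F` is of class `C^{2,α}`, with its first and second derivatives
and the `α`-Hölder seminorm of the second derivative bounded by `K`; moreover `F` is continuous
up to the boundary. -/
structure IsC2HolderMap {d : ℕ} (α K : ℝ) (U : Set (Space d)) (F : Space d → Space d) :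
    Prop where
  continuousOn : ContinuousOn F (closure U)
  contDiffOn : ContDiffOn ℝ 2 F U
  bound_one : ∀ x ∈ U, ‖fderiv ℝ F x‖ ≤ K
  bound_two : ∀ x ∈ U, ‖fderiv ℝ (fderiv ℝ F) x‖ ≤ K
  holder : ∀ x ∈ U, ∀ y ∈ U,
    ‖fderiv ℝ (fderiv ℝ F) x - fderiv ℝ (fderiv ℝ F) y‖ ≤ K * ‖x - y‖ ^ α

/-- `T` is an invertible `C^{2,α}` map from the closure of `Ω` onto the closed unit cylinder,
with inverse `S`, which maps boundary to boundary and cross sections to cross sections. -/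
structure IsStraightening {d : ℕ} (Ω : Set (Space d)) (α K : ℝ) (T S : Space d → Space d) :
    Prop where
  bijOn : BijOn T (closure Ω) (closure (unitCylinder d))
  invOn : InvOn S T (closure Ω) (closure (unitCylinder d))
  regular : IsC2HolderMap α K Ω T
  regular_inv : IsC2HolderMap α K (unitCylinder d) S
  image_frontier : T '' frontier Ω = frontier (unitCylinder d)
  image_section : ∀ k : ℝ,
    T '' (Ω ∩ {x | axial x = k}) = unitCylinder d ∩ {y | axial y = k}

/-- The basic assumptions on an infinitely long nozzle. -/
def IsNozzle {d : ℕ} (Ω : Set (Space d)) : Prop :=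
  IsOpen Ω ∧ ∃ α K : ℝ, 0 < α ∧ α < 1 ∧ ∃ T S : Space d → Space d, IsStraightening Ω α K T S

/-- `ν` is the outer unit normal of `Ω` at `x`: near `x`, the set `Ω` is tangent to the
half-space `{y | ⟨y - x, ν⟩ < 0}`, that is, up to cones of arbitrarily small opening around the
hyperplane, the points on the negative side lie in `Ω` and those on the positive side do not. -/
def IsOuterUnitNormal {d : ℕ} (Ω : Set (Space d)) (x ν : Space d) : Prop :=
  ‖ν‖ = 1 ∧ ∀ ε > 0, ∃ r > 0, ∀ y ∈ Metric.ball x r,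
    (inner ℝ (y - x) ν < -ε * ‖y - x‖ → y ∈ Ω) ∧
    (ε * ‖y - x‖ < inner ℝ (y - x) ν → y ∉ Ω)

/-! ### Potential flows -/

/-- The divergence of a vector field. -/
def divergence {d : ℕ} (F : Space d → Space d) (x : Space d) : ℝ :=
  ∑ i, fderiv ℝ F x (EuclideanSpace.single i 1) i

/-- The mass flux density `ρ(|∇φ|²) ∇φ` of the potential `φ`. -/
def massFluxDensity {d : ℕ} (ρ : ℝ → ℝ) (φ : Space d → ℝ) (x : Space d) : Space d :=
  ρ (‖∇ φ x‖ ^ 2) • ∇ φ x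

/-- `φ` is a uniformly subsonic solution in `Ω` of the potential equation
`div (ρ(|∇φ|²) ∇φ) = 0` with the no-flow condition `∂φ/∂n = 0` on the boundary:
`φ` is `C²` in `Ω`, its gradient extends continuously to the closure of `Ω`, and the supremum of
the speed is less than the critical speed. -/
structure IsUniformlySubsonicSolution {d : ℕ} (ρ : ℝ → ℝ) (qcr : ℝ) (Ω : Set (Space d))
    (φ : Space d → ℝ) : Prop where
  contDiffOn : ContDiffOn ℝ 2 φ Ω
  equation : ∀ x ∈ Ω, divergence (massFluxDensity ρ φ) x = 0
  noFlow : ∃ v : Space d → Space d, ContinuousOn v (closure Ω) ∧ (∀ x ∈ Ω, v x = ∇ φ x) ∧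
    ∀ x ∈ frontier Ω, ∃ ν, IsOuterUnitNormal Ω x ν ∧ inner ℝ (v x) ν = 0
  uniformlySubsonic : ∃ Q < qcr, ∀ x ∈ Ω, ‖∇ φ x‖ ≤ Q

/-- The mass flux of `φ` through the cross section `Ω ∩ {x_n = t}`, in the direction of the
longitudinal axis. -/
def massFlux {d : ℕ} (ρ : ℝ → ℝ) (Ω : Set (Space d)) (φ : Space d → ℝ) (t : ℝ) : ℝ :=
  ∫ z in {z : EuclideanSpace ℝ (Fin d) | sectionPoint z t ∈ Ω},
    axial (massFluxDensity ρ φ (sectionPoint z t))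

end

/-! Let ψ be the difference of the two potentials and G the difference of their mass flux densities.
Subsonicity makes a ↦ ρ(|a|²)a uniformly monotone and Lipschitz on the velocities that occur, so
l|∇ψ|² ≤ G·∇ψ and |G| ≤ Λ|∇ψ|. Moreover G is divergence-free, tangential on the wall, and has zero
flux through every cross section.

Test div G = 0 with a longitudinal cut-off times ψ. The energy E(a) of ψ in |x_n| < a is then
controlled by integrals of ψ·G_n over the two unit slabs beyond ±a. Since G has zero flux, a
constant may be subtracted from ψ in each slab, independently at the two ends, and Poincaré's
inequality bounds these integrals by the energy of the two slabs. The constant does not depend on a,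
because the straightening map has uniform bounds. Hence l E(a) ≤ C(E(a+1) − E(a)), that is, E(a) ≤
θE(a+1) with θ < 1 (`exists_energy_step`). Bounded gradients and the volume of slabs allow E only
polynomial growth, so E = 0 (`eq_zero_of_growth`). Nothing is asked of the nozzle at infinity.

The test function does not vanish on the wall, where the potentials need not be C². The weak
formulation therefore comes from a second cut-off, in a wall layer of thickness ε measured by |T'|²,
the squared norm of the transverse part of the straightening map T. Its gradient is of size 1/ε, the
layer has volume O(ε), and the component of the flux across the layer tends to 0 at the wall. For
this last fact the derivative of T is extended to the boundary and its conormal is compared with the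
outer normal (`inner_limit_nonpos`, `tendsto_inner_transverse`). -/

/-! ### The density-speed relation -/

namespace IsEquationOfState

variable {p : ℝ → ℝ}

theorem continuousOn_deriv (hp : IsEquationOfState p) : ContinuousOn (deriv p) (Ioi 0) :=
  hp.smooth.continuousOn_deriv_of_isOpen isOpen_Ioi (by simp)

theorem continuousOn_deriv_div (hp : IsEquationOfState p) :
    ContinuousOn (fun s => deriv p s / s) (Ioi 0) :=
  hp.continuousOn_deriv.div continuousOn_id fun _ hx => (mem_Ioi.1 hx).ne'

theorem strictMonoOn_deriv (hp : IsEquationOfState p) : StrictMonoOn (deriv p) (Ioi 0) := by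
  refine strictMonoOn_of_deriv_pos (convex_Ioi 0) hp.continuousOn_deriv fun x hx => ?_
  rw [interior_Ioi] at hx
  exact hp.deriv_deriv_pos x hx

theorem hasStrictDerivAt_enthalpy (hp : IsEquationOfState p) {r : ℝ} (hr : 0 < r) :
    HasStrictDerivAt (enthalpy p) (deriv p r / r) r := by
  have hc := hp.continuousOn_deriv_div
  have hsub : uIcc 1 r ⊆ Ioi 0 := fun x hx => lt_of_lt_of_le (lt_min one_pos hr) hx.1
  refine intervalIntegral.integral_hasStrictDerivAt_right ((hc.mono hsub).intervalIntegrable) ?_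
    (hc.continuousAt (Ioi_mem_nhds hr))
  exact ⟨Ioi 0, Ioi_mem_nhds hr, hc.aestronglyMeasurable measurableSet_Ioi⟩

theorem continuousOn_enthalpy (hp : IsEquationOfState p) : ContinuousOn (enthalpy p) (Ioi 0) :=
  fun _ hx => (hp.hasStrictDerivAt_enthalpy hx).hasDerivAt.continuousAt.continuousWithinAt

theorem strictMonoOn_enthalpy (hp : IsEquationOfState p) :
    StrictMonoOn (enthalpy p) (Ioi 0) := by
  refine strictMonoOn_of_deriv_pos (convex_Ioi 0) hp.continuousOn_enthalpy fun x hx => ?_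
  rw [interior_Ioi] at hx
  rw [(hp.hasStrictDerivAt_enthalpy hx).hasDerivAt.deriv]
  exact div_pos (hp.deriv_pos x hx) hx

/-- Convexity of p gives p'(s) ≥ p'(1) for s ≥ 1. The logarithm makes the enthalpy unbounded above,
so Bernoulli's law stays solvable however large B − t/2 is. -/
theorem mul_log_le_enthalpy (hp : IsEquationOfState p) {r : ℝ} (hr : 1 ≤ r) :
    deriv p 1 * Real.log r ≤ enthalpy p r := by
  have hsub : uIcc 1 r ⊆ Ioi 0 := fun x hx =>
    lt_of_lt_of_le (lt_min one_pos (by linarith)) hx.1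
  have h0 : deriv p 1 * Real.log r = ∫ s in (1 : ℝ)..r, deriv p 1 * s⁻¹ := by
    rw [intervalIntegral.integral_const_mul, integral_inv_of_pos one_pos (by linarith), div_one]
  rw [h0]
  refine intervalIntegral.integral_mono_on hr ?_
    ((hp.continuousOn_deriv_div.mono hsub).intervalIntegrable) fun s hs => ?_
  · refine ContinuousOn.intervalIntegrable (continuousOn_const.mul ?_)
    exact continuousOn_inv₀.mono fun x hx => (hsub hx).ne'
  · have hs0 : 0 < s := by linarith [hs.1]
    rw [div_eq_mul_inv]
    gcongr
    exact hp.strictMonoOn_deriv.monotoneOn (mem_Ioi.2 one_pos) hs0 hs.1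

theorem exists_lt_enthalpy (hp : IsEquationOfState p) (r b : ℝ) :
    ∃ R, r < R ∧ b < enthalpy p R := by
  have h1 : Tendsto (fun r => deriv p 1 * Real.log r) atTop atTop :=
    Real.tendsto_log_atTop.const_mul_atTop (hp.deriv_pos 1 one_pos)
  obtain ⟨R, hR, hR1, hR2⟩ := ((h1.eventually_gt_atTop b).and
    ((eventually_ge_atTop 1).and (eventually_gt_atTop r))).exists
  exact ⟨R, hR2, hR.trans_le (hp.mul_log_le_enthalpy hR1)⟩

end IsEquationOfState

/-- Here r is the critical density. Below critical speed Bernoulli's law asks for an enthalpy above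
that of r; the intermediate value theorem provides it, so `invFunOn` returns a genuine solution, and
monotonicity puts that solution above r. Since p' is increasing, the squared sound speed then
exceeds q². -/
theorem IsCriticalSpeed.exists_density_spec {p : ℝ → ℝ} (hp : IsEquationOfState p) {B q : ℝ}
    (hq : IsCriticalSpeed p B q) : ∃ r, 0 < r ∧ deriv p r = q ^ 2 ∧
      ∀ t < q ^ 2, r < density p B t ∧ enthalpy p (density p B t) = B - t / 2 := by
  obtain ⟨hq0, r, hr, hB, hs⟩ := hq
  have hd : deriv p r = q ^ 2 := by
    rw [hs, soundSpeed, Real.sq_sqrt (hp.deriv_pos r hr).le]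
  refine ⟨r, hr, hd, fun t ht => ?_⟩
  obtain ⟨R, hrR, hR⟩ := hp.exists_lt_enthalpy r (B - t / 2)
  obtain ⟨s, hs1, hs2⟩ := intermediate_value_Icc hrR.le
    (hp.continuousOn_enthalpy.mono fun x hx => hr.trans_le hx.1)
    (show B - t / 2 ∈ Icc (enthalpy p r) (enthalpy p R) from ⟨by linarith, hR.le⟩)
  have hex : B - t / 2 ∈ enthalpy p '' Ioi 0 := ⟨s, hr.trans_le hs1.1, hs2⟩
  have h1 : enthalpy p (density p B t) = B - t / 2 := Function.invFunOn_eq hex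
  have h2 : density p B t ∈ Ioi 0 := Function.invFunOn_mem hex
  refine ⟨?_, h1⟩
  rw [← hp.strictMonoOn_enthalpy.lt_iff_lt (mem_Ioi.2 hr) h2, h1]
  linarith

/-- Implicit differentiation of Bernoulli's law: 1/2 + (p'(ρ)/ρ)ρ' = 0. -/
theorem IsCriticalSpeed.hasDerivAt_density {p : ℝ → ℝ} (hp : IsEquationOfState p) {B q : ℝ}
    (hq : IsCriticalSpeed p B q) {t : ℝ} (ht : t < q ^ 2) :
    HasDerivAt (density p B) (-(density p B t / (2 * deriv p (density p B t)))) t := by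
  obtain ⟨r, hr, -, hspec⟩ := hq.exists_density_spec hp
  set s := density p B t with hs
  have hs0 : 0 < s := hr.trans (hspec t ht).1
  have hd := hp.hasStrictDerivAt_enthalpy hs0
  have hp' := hp.deriv_pos s hs0
  have hne : deriv p s / s ≠ 0 := (div_pos hp' hs0).ne'
  have hes : enthalpy p s = B - t / 2 := (hspec t ht).2
  have hg := hd.to_localInverse hne
  have hinv : ∀ᶠ y in 𝓝 (enthalpy p s), enthalpy p (hd.localInverse _ _ _ hne y) = y :=
    (hd.hasStrictFDerivAt_equiv hne).eventually_right_inverse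
  have hgs : hd.localInverse _ _ _ hne (enthalpy p s) = s :=
    (hd.hasStrictFDerivAt_equiv hne).localInverse_apply_image
  have hpos : ∀ᶠ y in 𝓝 (enthalpy p s), 0 < hd.localInverse _ _ _ hne y := by
    refine hg.hasDerivAt.continuousAt.eventually (lt_mem_nhds ?_)
    rw [hgs]; exact hs0
  have hlin : HasDerivAt (fun t : ℝ => B - t / 2) (-(1 / 2)) t :=
    ((hasDerivAt_id t).div_const 2).const_sub B
  have hlt : Tendsto (fun t : ℝ => B - t / 2) (𝓝 t) (𝓝 (enthalpy p s)) := by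
    rw [hes]; exact hlin.continuousAt
  have hcomp : HasDerivAt (fun t => hd.localInverse _ _ _ hne (B - t / 2))
      ((deriv p s / s)⁻¹ * (-(1 / 2))) t := by
    have hg' := hg.hasDerivAt
    rw [hes] at hg'
    exact hg'.comp t hlin
  -- The density is defined by choice. It agrees with the smooth local inverse because both are
  -- positive solutions of the same equation and the enthalpy is injective on positive densities.
  have heq : density p B =ᶠ[𝓝 t] fun t => hd.localInverse _ _ _ hne (B - t / 2) := by
    filter_upwards [hlt.eventually hinv, hlt.eventually hpos, Iio_mem_nhds ht] with u h1 h2 h3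
    exact hp.strictMonoOn_enthalpy.injOn (hr.trans (hspec u h3).1) h2 (by rw [h1, (hspec u h3).2])
  refine (hcomp.congr_of_eventuallyEq heq).congr_deriv ?_
  field_simp

theorem IsCriticalSpeed.contDiffOn_density {p : ℝ → ℝ} (hp : IsEquationOfState p) {B q : ℝ}
    (hq : IsCriticalSpeed p B q) : ContDiffOn ℝ 1 (density p B) (Iio (q ^ 2)) := by
  obtain ⟨r, hr, -, hspec⟩ := hq.exists_density_spec hp
  have hc : ContinuousOn (density p B) (Iio (q ^ 2)) := fun t ht =>
    (hq.hasDerivAt_density hp ht).continuousAt.continuousWithinAt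
  have hpos : ∀ t ∈ Iio (q ^ 2), density p B t ∈ Ioi 0 := fun t ht => hr.trans (hspec t ht).1
  rw [show (1 : WithTop ℕ∞) = 0 + 1 by simp, contDiffOn_succ_iff_deriv_of_isOpen isOpen_Iio]
  refine ⟨fun t ht => (hq.hasDerivAt_density hp ht).differentiableAt.differentiableWithinAt,
    by simp, ?_⟩
  rw [contDiffOn_zero]
  refine ContinuousOn.congr (f := fun t => -(density p B t / (2 * deriv p (density p B t)))) ?_
    fun t ht => (hq.hasDerivAt_density hp ht).deriv
  refine (hc.div (continuousOn_const.mul (hp.continuousOn_deriv.comp hc hpos)) ?_).neg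
  intro t ht
  exact (mul_pos two_pos (hp.deriv_pos _ (hpos t ht))).ne'

/-- The mass flux as a function of the speed is uniformly increasing on subsonic speeds. -/
theorem IsCriticalSpeed.exists_scalar_ellipticity {p : ℝ → ℝ} (hp : IsEquationOfState p)
    {B q : ℝ} (hq : IsCriticalSpeed p B q) {Q : ℝ} (hQ0 : 0 ≤ Q) (hQ : Q < q) :
    ∃ l > 0, (∀ a ∈ Icc 0 Q, l ≤ density p B (a ^ 2)) ∧
      ∀ a ∈ Icc 0 Q, ∀ b ∈ Icc 0 Q, l * (a - b) ^ 2 ≤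
        (density p B (a ^ 2) * a - density p B (b ^ 2) * b) * (a - b) := by
  obtain ⟨r, hr, hdr, hspec⟩ := hq.exists_density_spec hp
  have hq0 := hq.1
  have hlt : ∀ a ∈ Icc 0 Q, a ^ 2 < q ^ 2 := fun a ha => by
    have := ha.1; have := ha.2; nlinarith
  set m : ℝ → ℝ := fun a => density p B (a ^ 2) * a
  -- The derivative of a ↦ ρ(a²)a is ρ(1 − a²/p'(ρ)). Inserting ρ ≥ r, p'(ρ) ≥ q² and a ≤ Q gives
  -- this lower bound.
  set l := r * (1 - Q ^ 2 / q ^ 2) with hl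
  have hQq : Q ^ 2 / q ^ 2 < 1 := by
    rw [div_lt_one (by positivity)]; exact hlt Q ⟨hQ0, le_rfl⟩
  have hl0 : 0 < l := mul_pos hr (by linarith)
  have hlr : l ≤ r := mul_le_of_le_one_right hr.le (by linarith [show 0 ≤ Q ^ 2 / q ^ 2 by positivity])
  have hder : ∀ a ∈ Icc 0 Q, ∃ D, l ≤ D ∧ HasDerivAt m D a := by
    intro a ha
    have h1 := hspec _ (hlt a ha)
    set s := density p B (a ^ 2) with hs
    have hs0 : 0 < s := hr.trans h1.1
    have hps := hp.deriv_pos s hs0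
    have hpq : q ^ 2 ≤ deriv p s := by
      rw [← hdr]; exact (hp.strictMonoOn_deriv (mem_Ioi.2 hr) hs0 h1.1).le
    have h2 := (HasDerivAt.comp (h := fun a : ℝ => a ^ 2) a (hq.hasDerivAt_density hp (hlt a ha))
      (hasDerivAt_pow 2 a)).mul (hasDerivAt_id a)
    refine ⟨_, ?_, h2⟩
    have h3 : a ^ 2 / deriv p s ≤ Q ^ 2 / q ^ 2 := by
      have := ha.1; have := ha.2
      gcongr
    have h4 : l ≤ s * (1 - a ^ 2 / deriv p s) := by
      rw [hl]
      have := h1.1.le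
      gcongr
    refine h4.trans (le_of_eq ?_)
    simp only [Function.comp, id, ← hs]
    field_simp
    ring
  refine ⟨l, hl0, fun a ha => hlr.trans (hspec _ (hlt a ha)).1.le, ?_⟩
  have hmono : ∀ a ∈ Icc 0 Q, ∀ b ∈ Icc 0 Q, b ≤ a → l * (a - b) ≤ m a - m b := by
    intro a ha b hb hba
    refine (convex_Icc 0 Q).mul_sub_le_image_sub_of_le_deriv ?_ ?_ ?_ b hb a ha hba
    · intro x hx
      obtain ⟨D, -, hD⟩ := hder x hx
      exact hD.continuousAt.continuousWithinAt
    · intro x hx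
      obtain ⟨D, -, hD⟩ := hder x (interior_subset hx)
      exact hD.differentiableAt.differentiableWithinAt
    · intro x hx
      obtain ⟨D, h, hD⟩ := hder x (interior_subset hx)
      rwa [hD.deriv]
  intro a ha b hb
  change _ ≤ (m a - m b) * (a - b)
  rcases le_total b a with h | h
  · have := hmono a ha b hb h
    nlinarith
  · have := hmono b hb a ha h
    nlinarith

/-- The map `a ↦ ρ(|a|²) a` is uniformly monotone on subsonic velocities. -/
theorem IsCriticalSpeed.exists_monotone {p : ℝ → ℝ} (hp : IsEquationOfState p)
    {B q : ℝ} (hq : IsCriticalSpeed p B q) {Q : ℝ} (hQ0 : 0 ≤ Q) (hQ : Q < q)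
    {E : Type*} [NormedAddCommGroup E] [InnerProductSpace ℝ E] :
    ∃ l > 0, ∀ a b : E, ‖a‖ ≤ Q → ‖b‖ ≤ Q → l * ‖a - b‖ ^ 2 ≤
      inner ℝ (density p B (‖a‖ ^ 2) • a - density p B (‖b‖ ^ 2) • b) (a - b) := by
  obtain ⟨l, hl, h1, h2⟩ := hq.exists_scalar_ellipticity hp hQ0 hQ
  refine ⟨l, hl, fun a b ha hb => ?_⟩
  have ha' : ‖a‖ ∈ Icc 0 Q := ⟨norm_nonneg a, ha⟩
  have hb' : ‖b‖ ∈ Icc 0 Q := ⟨norm_nonneg b, hb⟩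
  have e1 := h1 _ ha'
  have e2 := h1 _ hb'
  have e3 := h2 _ ha' _ hb'
  have hab : inner ℝ a b ≤ ‖a‖ * ‖b‖ := real_inner_le_norm a b
  -- With ρₐ, ρ_b the two densities, the right side is (ρₐ|a| − ρ_b|b|)(|a| − |b|) + (ρₐ +
  -- ρ_b)(|a||b| − ⟨a,b⟩), while |a − b|² = (|a| − |b|)² + 2(|a||b| − ⟨a,b⟩). The scalar estimate
  -- and ρₐ, ρ_b ≥ l compare them term by term.
  rw [norm_sub_sq_real]
  simp only [inner_sub_left, inner_sub_right, real_inner_smul_left, real_inner_self_eq_norm_sq,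
    real_inner_comm a b]
  nlinarith [mul_nonneg (sub_nonneg.2 e1) (sub_nonneg.2 hab),
    mul_nonneg (sub_nonneg.2 e2) (sub_nonneg.2 hab)]

/-- The map `a ↦ ρ(|a|²) a` is bounded and Lipschitz on subsonic velocities. -/
theorem IsCriticalSpeed.exists_lipschitz {p : ℝ → ℝ} (hp : IsEquationOfState p)
    {B q : ℝ} (hq : IsCriticalSpeed p B q) {Q : ℝ} (hQ0 : 0 ≤ Q) (hQ : Q < q)
    {E : Type*} [NormedAddCommGroup E] [InnerProductSpace ℝ E] :
    ∃ l ≥ 0, ∀ a b : E, ‖a‖ ≤ Q → ‖b‖ ≤ Q →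
      ‖density p B (‖a‖ ^ 2) • a - density p B (‖b‖ ^ 2) • b‖ ≤ l * ‖a - b‖ := by
  have hlt : ∀ a ∈ Icc 0 Q, a ^ 2 < q ^ 2 := fun a ha => by
    have := ha.1; have := ha.2; nlinarith
  have hcd : ContDiffOn ℝ 1 (fun a => density p B (a ^ 2)) (Icc 0 Q) :=
    (hq.contDiffOn_density hp).comp ((contDiff_id.pow 2).contDiffOn) hlt
  obtain ⟨M, hM⟩ := isCompact_Icc.exists_bound_of_continuousOn hcd.continuousOn
  obtain ⟨L, hL⟩ := hcd.exists_lipschitzOnWith (by simp) (convex_Icc 0 Q) isCompact_Icc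
  have hM0 : 0 ≤ M := (norm_nonneg _).trans (hM 0 ⟨le_rfl, hQ0⟩)
  refine ⟨M + L * Q, by positivity, fun a b ha hb => ?_⟩
  have ha' : ‖a‖ ∈ Icc 0 Q := ⟨norm_nonneg a, ha⟩
  have hb' : ‖b‖ ∈ Icc 0 Q := ⟨norm_nonneg b, hb⟩
  have e : density p B (‖a‖ ^ 2) • a - density p B (‖b‖ ^ 2) • b =
      density p B (‖a‖ ^ 2) • (a - b) + (density p B (‖a‖ ^ 2) - density p B (‖b‖ ^ 2)) • b := by
    module
  rw [e]
  refine (norm_add_le _ _).trans ?_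
  rw [norm_smul, norm_smul, add_mul]
  have h1 := hM _ ha'
  have h2 : ‖density p B (‖a‖ ^ 2) - density p B (‖b‖ ^ 2)‖ ≤ L * ‖a - b‖ := by
    refine (hL.norm_sub_le ha' hb').trans ?_
    gcongr
    exact abs_norm_sub_norm_le a b
  calc _ ≤ M * ‖a - b‖ + (L * ‖a - b‖) * Q := by gcongr
    _ = _ := by ring

/-! ### Integration by parts and Fubini's theorem -/

theorem divergence_smul {d : ℕ} {η : Space d → ℝ} {F : Space d → Space d} {x : Space d}
    (hη : DifferentiableAt ℝ η x) (hF : DifferentiableAt ℝ F x) :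
    divergence (fun y => η y • F y) x = η x * divergence F x + fderiv ℝ η x (F x) := by
  have h1 : F x = ∑ i, F x i • EuclideanSpace.single i (1 : ℝ) := by
    conv_lhs => rw [← (EuclideanSpace.basisFun (Fin (d + 1)) ℝ).sum_repr (F x)]
    simp
  have h2 : fderiv ℝ η x (F x) = ∑ i, F x i * fderiv ℝ η x (EuclideanSpace.single i 1) := by
    conv_lhs => rw [h1]
    simp
  rw [h2, divergence, divergence, Finset.mul_sum, ← Finset.sum_add_distrib]
  refine Finset.sum_congr rfl fun i _ => ?_
  rw [fderiv_fun_smul hη hF]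
  simp
  ring

theorem integral_divergence_eq_zero {d : ℕ} {X : Space d → Space d} (hX : ContDiff ℝ 1 X)
    (hs : HasCompactSupport X) : ∫ x, divergence X x = 0 := by
  have hc : ∀ v, Continuous fun x => fderiv ℝ X x v := fun v =>
    (hX.continuous_fderiv (by simp)).clm_apply continuous_const
  have hi : ∀ v, Integrable fun x => fderiv ℝ X x v := fun v =>
    (hc v).integrable_of_hasCompactSupport (hs.fderiv_apply (𝕜 := ℝ) v)
  have h0 : ∀ v, ∫ x, fderiv ℝ X x v = 0 := by
    intro v
    -- Integration by parts against the constant 1.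
    have := integral_smul_fderiv_eq_neg_fderiv_smul_of_integrable (μ := volume) (𝕜 := ℝ)
      (f := fun _ => (1 : ℝ)) (g := X) (v := v) (by simp) (by simpa using hi v)
      (by simpa using hX.continuous.integrable_of_hasCompactSupport hs)
      (fun x _ => differentiableAt_const _) (fun x _ => hX.differentiable (by simp) x)
    simpa using this
  have hp : ∀ (i : Fin (d + 1)) v, Integrable fun x => fderiv ℝ X x v i := fun i v =>
    (EuclideanSpace.proj i : Space d →L[ℝ] ℝ).integrable_comp (hi v)
  simp only [divergence]
  rw [integral_finsetSum _ fun i _ => hp i _]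
  refine Finset.sum_eq_zero fun i _ => ?_
  have := (EuclideanSpace.proj i : Space d →L[ℝ] ℝ).integral_comp_comm
    (hi (EuclideanSpace.single i 1))
  rw [h0] at this
  simpa using this

theorem setIntegral_fderiv_apply_eq_zero {d : ℕ} {Ω : Set (Space d)} (hΩ : IsOpen Ω)
    {F : Space d → Space d} (hF : ContDiffOn ℝ 1 F Ω) (hdiv : ∀ x ∈ Ω, divergence F x = 0)
    {η : Space d → ℝ} (hη : ContDiffOn ℝ 1 η Ω) {k : Set (Space d)} (hk : IsCompact k)
    (hkΩ : k ⊆ Ω) (hsupp : ∀ x ∈ Ω, x ∉ k → η x = 0) :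
    ∫ x in Ω, fderiv ℝ η x (F x) = 0 := by
  -- Extension by zero is C¹ on the whole space because η vanishes in Ω off a compact subset of Ω.
  -- No regularity of the boundary enters.
  set X := Ω.indicator fun x => η x • F x with hX
  have hX0 : ∀ x ∉ k, X x = 0 := fun x hx => by
    by_cases h : x ∈ Ω
    · simp [hX, h, hsupp x h hx]
    · simp [hX, h]
  have heq : ∀ x ∈ Ω, X =ᶠ[𝓝 x] fun x => η x • F x := fun x hx => by
    filter_upwards [hΩ.mem_nhds hx] with y hy
    simp [hX, hy]
  have heq0 : ∀ x ∉ Ω, X =ᶠ[𝓝 x] fun _ => 0 := fun x hx => by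
    filter_upwards [hk.isClosed.isOpen_compl.mem_nhds fun h => hx (hkΩ h)] with y hy
    exact hX0 y hy
  have hXc : ContDiff ℝ 1 X := by
    rw [contDiff_iff_contDiffAt]
    intro x
    by_cases hx : x ∈ Ω
    · exact ((hη.contDiffAt (hΩ.mem_nhds hx)).smul
        (hF.contDiffAt (hΩ.mem_nhds hx))).congr_of_eventuallyEq (heq x hx)
    · exact contDiffAt_const.congr_of_eventuallyEq (heq0 x hx)
  rw [← integral_divergence_eq_zero hXc (HasCompactSupport.intro hk hX0),
    ← integral_indicator hΩ.measurableSet]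
  congr 1
  ext x
  by_cases hx : x ∈ Ω
  · rw [indicator_of_mem hx]
    have h1 := divergence_smul ((hη.differentiableOn (by simp)).differentiableAt (hΩ.mem_nhds hx))
      ((hF.differentiableOn (by simp)).differentiableAt (hΩ.mem_nhds hx))
    rw [hdiv x hx, mul_zero, zero_add] at h1
    rw [← h1, divergence, divergence, (heq x hx).fderiv_eq]
  · rw [indicator_of_notMem hx, divergence, (heq0 x hx).fderiv_eq]
    simp

/-- Cylindrical coordinates `(t, z) ↦ (z, t)`. -/
def sectionEquiv (d : ℕ) : (ℝ × EuclideanSpace ℝ (Fin d)) ≃ᵐ Space d :=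
  ((MeasurableEquiv.refl ℝ).prodCongr (MeasurableEquiv.toLp 2 (Fin d → ℝ)).symm).trans
    ((MeasurableEquiv.piFinSuccAbove (fun _ : Fin (d + 1) => ℝ) (Fin.last d)).symm.trans
      (MeasurableEquiv.toLp 2 (Fin (d + 1) → ℝ)))

theorem sectionEquiv_apply {d : ℕ} (t : ℝ) (z : EuclideanSpace ℝ (Fin d)) :
    sectionEquiv d (t, z) = sectionPoint z t := by
  simp only [sectionEquiv, sectionPoint, MeasurableEquiv.trans_apply, MeasurableEquiv.toLp_apply]
  congr 1
  exact Fin.insertNth_last' t (fun i => z i)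

theorem measurePreserving_sectionEquiv (d : ℕ) : MeasurePreserving (sectionEquiv d) := by
  refine ((MeasurePreserving.id volume).prod
    (PiLp.volume_preserving_ofLp (Fin d))).trans (MeasurePreserving.trans ?_
      (PiLp.volume_preserving_toLp (Fin (d + 1))))
  exact (volume_preserving_piFinSuccAbove (fun _ : Fin (d + 1) => ℝ) (Fin.last d)).symm

theorem axial_sectionPoint {d : ℕ} (z : EuclideanSpace ℝ (Fin d)) (t : ℝ) :
    axial (sectionPoint z t) = t := by
  simp [axial, sectionPoint]

theorem setIntegral_axial_mul {d : ℕ} {Ω : Set (Space d)} (hΩ : MeasurableSet Ω) {w : ℝ → ℝ}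
    {g : Space d → ℝ} (hi : IntegrableOn (fun x => w (axial x) * g x) Ω) :
    ∫ x in Ω, w (axial x) * g x =
      ∫ t, w t * ∫ z in {z | sectionPoint z t ∈ Ω}, g (sectionPoint z t) := by
  have hmp := measurePreserving_sectionEquiv d
  rw [← integral_indicator hΩ, ← hmp.integral_comp (sectionEquiv d).measurableEmbedding]
  have hi' := (hmp.integrable_comp_emb (sectionEquiv d).measurableEmbedding).2
    (hi.integrable_indicator hΩ)
  change ∫ y : ℝ × EuclideanSpace ℝ (Fin d), _ ∂(volume.prod volume) = _
  refine (integral_prod _ hi').trans ?_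
  congr 1
  ext t
  have hms : MeasurableSet {z : EuclideanSpace ℝ (Fin d) | sectionPoint z t ∈ Ω} := by
    simp only [← sectionEquiv_apply]
    exact ((sectionEquiv d).measurable.comp measurable_prodMk_left) hΩ
  rw [← integral_const_mul, ← integral_indicator hms]
  congr 1
  ext z
  rw [Function.comp_apply, sectionEquiv_apply]
  by_cases hz : sectionPoint z t ∈ Ω
  · rw [indicator_of_mem hz, indicator_of_mem (show z ∈ {z | sectionPoint z t ∈ Ω} from hz),
      axial_sectionPoint]
  · rw [indicator_of_notMem hz, indicator_of_notMem (show z ∉ {z | sectionPoint z t ∈ Ω} from hz)]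

/-- The right side depends on the flow only through m, so two flows of equal flux have the same
weighted flux for every longitudinal weight satisfying the integrability condition. -/
theorem setIntegral_axial_mul_massFluxDensity {d : ℕ} {Ω : Set (Space d)} (hΩ : MeasurableSet Ω)
    {ρ : ℝ → ℝ} {φ : Space d → ℝ} {m : ℝ} (hm : ∀ t, massFlux ρ Ω φ t = m) {w : ℝ → ℝ}
    (hi : IntegrableOn (fun x => w (axial x) * axial (massFluxDensity ρ φ x)) Ω) :
    ∫ x in Ω, w (axial x) * axial (massFluxDensity ρ φ x) = ∫ t, w t * m := by
  rw [setIntegral_axial_mul hΩ hi]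
  congr 1
  ext t
  rw [← hm t, massFlux]

/-! ### The Poincaré inequality on convex sets -/

theorem sq_sub_le_mul_integral_sq_deriv {w w' : ℝ → ℝ} {a b : ℝ} (hab : a < b)
    (hw : ∀ s ∈ Icc a b, HasDerivAt w (w' s) s) (hc : ContinuousOn w' (Icc a b)) :
    (w b - w a) ^ 2 ≤ (b - a) * ∫ s in a..b, w' s ^ 2 := by
  rw [← uIcc_of_le hab.le] at hw hc
  have hI : ∫ s in a..b, w' s = w b - w a :=
    intervalIntegral.integral_eq_sub_of_hasDerivAt hw hc.intervalIntegrable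
  -- The Cauchy–Schwarz inequality in the form that the variance of w' about its mean c is
  -- nonnegative.
  set c := (w b - w a) / (b - a) with hcdef
  have h0 : 0 ≤ ∫ s in a..b, (w' s - c) ^ 2 :=
    intervalIntegral.integral_nonneg hab.le fun _ _ => sq_nonneg _
  have h1 : ∫ s in a..b, (w' s - c) ^ 2 =
      (∫ s in a..b, w' s ^ 2) - 2 * c * (w b - w a) + (b - a) * c ^ 2 := by
    have i1 : IntervalIntegrable (fun s => w' s ^ 2) volume a b := (hc.pow 2).intervalIntegrable
    have i2 : IntervalIntegrable (fun s => 2 * c * w' s) volume a b :=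
      hc.intervalIntegrable.const_mul _
    have e : (fun s => (w' s - c) ^ 2) = fun s => w' s ^ 2 - 2 * c * w' s + c ^ 2 := by
      ext s; ring
    rw [e, intervalIntegral.integral_add (i1.sub i2) (by simp), intervalIntegral.integral_sub i1 i2,
      intervalIntegral.integral_const_mul, hI, intervalIntegral.integral_const, smul_eq_mul]
  have hba : 0 < b - a := sub_pos.2 hab
  have h2 : w b - w a = c * (b - a) := by rw [hcdef]; field_simp
  rw [h1, h2] at h0
  rw [h2]
  nlinarith

theorem enorm_sq_eq_ofReal (a : ℝ) : ‖a‖ₑ ^ 2 = ENNReal.ofReal (a ^ 2) := by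
  rw [← ofReal_norm, ← ENNReal.ofReal_pow (norm_nonneg _), Real.norm_eq_abs, sq_abs]

theorem lintegral_lintegral_symm {α : Type*} [MeasurableSpace α] (μ : Measure α) [SFinite μ]
    {k : α → α → ENNReal} (hk : Measurable (Function.uncurry k)) :
    ∫⁻ y, ∫⁻ x, 2 * (k x y + k y x) ∂μ ∂μ = 4 * ∫⁻ y, ∫⁻ x, k x y ∂μ ∂μ := by
  have hk1 : Measurable fun y => ∫⁻ x, k x y ∂μ := hk.lintegral_prod_left'
  have h1 : ∀ y, ∫⁻ x, 2 * (k x y + k y x) ∂μ = 2 * ((∫⁻ x, k x y ∂μ) + ∫⁻ x, k y x ∂μ) :=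
    fun y => by
      rw [lintegral_const_mul' _ _ ENNReal.ofNat_ne_top,
        lintegral_add_left (f := fun x => k x y) (hk.comp measurable_prodMk_right)]
  simp_rw [h1]
  rw [lintegral_const_mul' _ _ ENNReal.ofNat_ne_top, lintegral_add_left hk1,
    lintegral_lintegral_swap (f := fun y x => k y x) hk.aemeasurable]
  ring

section Poincare

variable {E : Type*} [NormedAddCommGroup E] [NormedSpace ℝ E]

/-- Comparing x with the midpoint, rather than with y, keeps s in [1/2, 1]. The dilation x ↦ (1 −
s)y + sx is then uniformly invertible, which the integration over x needs. The factor 1/2 in the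
constant is the length of that interval. -/
theorem enorm_sub_midpoint_sq_le {U : Set E} (hU : IsOpen U) {u : E → ℝ}
    (hu : ContDiffOn ℝ 1 u U) {x y : E} (hxy : segment ℝ x y ⊆ U) {R : ℝ} (hR : ‖x - y‖ ≤ R) :
    ‖u x - u ((1 / 2 : ℝ) • y + (1 / 2 : ℝ) • x)‖ₑ ^ 2 ≤ ENNReal.ofReal (R ^ 2 / 2) *
      ∫⁻ s in Icc (1 / 2 : ℝ) 1, ‖fderiv ℝ u ((1 - s) • y + s • x)‖ₑ ^ 2 := by
  set γ : ℝ → E := fun s => (1 - s) • y + s • x with hγ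
  have hR0 : 0 ≤ R := (norm_nonneg _).trans hR
  have hmem : ∀ s ∈ Icc (1 / 2 : ℝ) 1, γ s ∈ U := fun s hs => by
    refine hxy ?_
    rw [segment_symm]
    exact ⟨1 - s, s, by linarith [hs.2], by linarith [hs.1], by ring, rfl⟩
  have hγ' : ∀ s, HasDerivAt γ (x - y) s := fun s => by
    have := (((hasDerivAt_id s).const_sub 1).smul_const y).add ((hasDerivAt_id s).smul_const x)
    exact this.congr_deriv (by module)
  have hγc : Continuous γ := by fun_prop
  have hDc : ContinuousOn (fun s => fderiv ℝ u (γ s)) (Icc (1 / 2 : ℝ) 1) :=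
    (hu.continuousOn_fderiv_of_isOpen hU (by simp)).comp hγc.continuousOn hmem
  have h1 := sq_sub_le_mul_integral_sq_deriv (w := fun s => u (γ s))
    (w' := fun s => fderiv ℝ u (γ s) (x - y)) (a := 1 / 2) (b := 1) (by norm_num)
    (fun s hs => (((hu.differentiableOn (by simp)).differentiableAt
      (hU.mem_nhds (hmem s hs))).hasFDerivAt.comp_hasDerivAt s (hγ' s)))
    (hDc.clm_apply continuousOn_const)
  have hi : IntervalIntegrable (fun s => ‖fderiv ℝ u (γ s)‖ ^ 2) volume (1 / 2) 1 := by
    refine ContinuousOn.intervalIntegrable ?_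
    rw [uIcc_of_le (by norm_num)]
    exact hDc.norm.pow 2
  have h2 : ∫ s in (1 / 2 : ℝ)..1, (fderiv ℝ u (γ s) (x - y)) ^ 2 ≤
      ∫ s in (1 / 2 : ℝ)..1, ‖fderiv ℝ u (γ s)‖ ^ 2 * R ^ 2 := by
    refine intervalIntegral.integral_mono_on (by norm_num) ?_ (hi.mul_const _) fun s _ => ?_
    · refine ContinuousOn.intervalIntegrable ?_
      rw [uIcc_of_le (by norm_num)]
      exact (hDc.clm_apply continuousOn_const).pow 2
    · rw [← mul_pow, ← sq_abs]
      have := (fderiv ℝ u (γ s)).le_opNorm (x - y)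
      rw [Real.norm_eq_abs] at this
      gcongr
      exact this.trans (by gcongr)
  rw [intervalIntegral.integral_mul_const] at h2
  have e1 : u (γ 1) = u x := by simp [hγ]
  have e2 : u (γ (1 / 2)) = u ((1 / 2 : ℝ) • y + (1 / 2 : ℝ) • x) := by
    simp only [hγ]; norm_num
  have h3 : ‖u x - u ((1 / 2 : ℝ) • y + (1 / 2 : ℝ) • x)‖ ^ 2 ≤
      R ^ 2 / 2 * ∫ s in (1 / 2 : ℝ)..1, ‖fderiv ℝ u (γ s)‖ ^ 2 := by
    rw [Real.norm_eq_abs, sq_abs, ← e1, ← e2]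
    refine h1.trans ?_
    linarith
  have h4 : ENNReal.ofReal (∫ s in (1 / 2 : ℝ)..1, ‖fderiv ℝ u (γ s)‖ ^ 2) =
      ∫⁻ s in Icc (1 / 2 : ℝ) 1, ‖fderiv ℝ u (γ s)‖ₑ ^ 2 := by
    rw [intervalIntegral.integral_of_le (by norm_num), ← integral_Icc_eq_integral_Ioc,
      ofReal_integral_eq_lintegral_ofReal]
    · simp_rw [ENNReal.ofReal_pow (norm_nonneg _), ofReal_norm]
    · exact (hDc.norm.pow 2).integrableOn_Icc
    · exact Eventually.of_forall fun _ => by positivity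
  rw [← h4, ← ENNReal.ofReal_mul (by positivity), ← ofReal_norm,
    ← ENNReal.ofReal_pow (norm_nonneg _)]
  exact ENNReal.ofReal_le_ofReal h3

variable [FiniteDimensional ℝ E] [MeasurableSpace E] [BorelSpace E]

theorem lintegral_comp_add_smul (μ : Measure E) [μ.IsAddHaarMeasure] {g : E → ENNReal}
    (hg : Measurable g) (c : E) {s : ℝ} (hs : s ≠ 0) :
    ∫⁻ x, g (c + s • x) ∂μ = ENNReal.ofReal |(s ^ Module.finrank ℝ E)⁻¹| * ∫⁻ x, g x ∂μ := by
  have h := lintegral_map (μ := μ) (f := fun x => g (c + x)) (g := fun x => s • x)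
    (hg.comp (measurable_const_add c)) (measurable_const_smul s)
  rw [← h, Measure.map_addHaar_smul μ hs, lintegral_smul_measure, smul_eq_mul,
    lintegral_add_left_eq_self]

theorem lintegral_sub_midpoint_sq_le (μ : Measure E) [μ.IsAddHaarMeasure] {Q : Set E}
    (hQ : IsOpen Q) (hconv : Convex ℝ Q) {R : ℝ}
    (hR : ∀ x ∈ Q, ∀ y ∈ Q, ‖x - y‖ ≤ R) {u : E → ℝ} (hu : ContDiffOn ℝ 1 u Q) {y : E}
    (hy : y ∈ Q) :
    ∫⁻ x in Q, ‖u x - u ((1 / 2 : ℝ) • y + (1 / 2 : ℝ) • x)‖ₑ ^ 2 ∂μ ≤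
      ENNReal.ofReal (R ^ 2 / 2) * 2 ^ Module.finrank ℝ E *
        ∫⁻ x in Q, ‖fderiv ℝ u x‖ₑ ^ 2 ∂μ := by
  set D := ∫⁻ x in Q, ‖fderiv ℝ u x‖ₑ ^ 2 ∂μ with hD
  -- Cut off outside Q, the integrand can be integrated over the whole space, where dilations and
  -- translations act without tracking the images of Q. The Jacobian factor is s⁻ⁿ ≤ 2ⁿ, with n the
  -- dimension of E.
  set g : E → ENNReal := Q.indicator fun x => ‖fderiv ℝ u x‖ₑ ^ 2 with hg
  have hgm : Measurable g :=
    (((measurable_fderiv ℝ u).enorm).pow_const 2).indicator hQ.measurableSet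
  have hm : Measurable fun q : E × ℝ => g ((1 - q.2) • y + q.2 • q.1) :=
    hgm.comp (by fun_prop)
  calc _ ≤ ∫⁻ x in Q, ENNReal.ofReal (R ^ 2 / 2) *
        (∫⁻ s in Icc (1 / 2 : ℝ) 1, g ((1 - s) • y + s • x)) ∂μ := by
        refine setLIntegral_mono' hQ.measurableSet fun x hx => ?_
        refine (enorm_sub_midpoint_sq_le hQ hu (hconv.segment_subset hx hy)
          (hR x hx y hy)).trans ?_
        refine mul_le_mul_right (setLIntegral_mono' (μ := volume) measurableSet_Icc fun s hs => ?_) _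
        rw [hg, indicator_of_mem]
        exact hconv hy hx (by linarith [hs.2]) (by linarith [hs.1]) (by ring)
    _ ≤ ∫⁻ x, ENNReal.ofReal (R ^ 2 / 2) *
        (∫⁻ s in Icc (1 / 2 : ℝ) 1, g ((1 - s) • y + s • x)) ∂μ := setLIntegral_le_lintegral _ _
    _ = ENNReal.ofReal (R ^ 2 / 2) *
        ∫⁻ s in Icc (1 / 2 : ℝ) 1, (∫⁻ x, g ((1 - s) • y + s • x) ∂μ) := by
        rw [lintegral_const_mul' _ _ ENNReal.ofReal_ne_top]
        congr 1
        exact lintegral_lintegral_swap (f := fun x s => g ((1 - s) • y + s • x)) hm.aemeasurable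
    _ ≤ ENNReal.ofReal (R ^ 2 / 2) *
        ∫⁻ s in Icc (1 / 2 : ℝ) 1, 2 ^ Module.finrank ℝ E * D := by
        refine mul_le_mul_right (setLIntegral_mono' (μ := volume) measurableSet_Icc fun s hs => ?_) _
        have hs0 : 0 < s := by linarith [hs.1]
        rw [lintegral_comp_add_smul μ hgm _ hs0.ne', hg, lintegral_indicator hQ.measurableSet]
        gcongr
        rw [abs_of_nonneg (by positivity), ← inv_pow, ENNReal.ofReal_pow (by positivity)]
        gcongr
        rw [← ENNReal.ofReal_ofNat 2]
        refine ENNReal.ofReal_le_ofReal ?_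
        rw [inv_le_comm₀ hs0 two_pos]
        linarith [hs.1]
    _ ≤ ENNReal.ofReal (R ^ 2 / 2) * (2 ^ Module.finrank ℝ E * D) := by
        gcongr
        rw [setLIntegral_const, Real.volume_Icc]
        refine mul_le_of_le_one_right' ?_
        rw [ENNReal.ofReal_le_one]
        norm_num
    _ = _ := by rw [mul_assoc]

/-- Poincaré's inequality, with a constant that depends only on the dimension and the diameter. -/
theorem exists_lintegral_sub_sq_le (μ : Measure E) [μ.IsAddHaarMeasure] {Q : Set E}
    (hQ : IsOpen Q) (hconv : Convex ℝ Q) (hne : Q.Nonempty) {R : ℝ}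
    (hR : ∀ x ∈ Q, ∀ y ∈ Q, ‖x - y‖ ≤ R) {u : E → ℝ} (hu : ContDiffOn ℝ 1 u Q) :
    ∃ c : ℝ, ∫⁻ x in Q, ‖u x - c‖ₑ ^ 2 ∂μ ≤
      4 * (ENNReal.ofReal (R ^ 2 / 2) * 2 ^ Module.finrank ℝ E) *
        ∫⁻ x in Q, ‖fderiv ℝ u x‖ₑ ^ 2 ∂μ := by
  classical
  have hμ0 : μ Q ≠ 0 := (hQ.measure_pos μ hne).ne'
  have hbdd : Bornology.IsBounded Q := by
    refine Metric.isBounded_iff.2 ⟨R, fun x hx y hy => ?_⟩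
    rw [dist_eq_norm]; exact hR x hx y hy
  have hμt : μ Q ≠ ⊤ := hbdd.measure_lt_top.ne
  set D := ∫⁻ x in Q, ‖fderiv ℝ u x‖ₑ ^ 2 ∂μ with hD
  set C := ENNReal.ofReal (R ^ 2 / 2) * 2 ^ Module.finrank ℝ E with hC
  have hmid : ∀ x ∈ Q, ∀ y ∈ Q, (1 / 2 : ℝ) • y + (1 / 2 : ℝ) • x ∈ Q := fun x hx y hy =>
    hconv hy hx (by norm_num) (by norm_num) (by norm_num)
  have hone : ∀ y ∈ Q,
      ∫⁻ x in Q, ‖u x - u ((1 / 2 : ℝ) • y + (1 / 2 : ℝ) • x)‖ₑ ^ 2 ∂μ ≤ C * D := fun y hy =>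
    lintegral_sub_midpoint_sq_le μ hQ hconv hR hu hy
  -- Off Q nothing is known about u; the extension by zero is globally measurable, as Tonelli's
  -- theorem requires.
  set v : E → ℝ := Q.piecewise u 0 with hv
  have hvm : Measurable v := hu.continuousOn.measurable_piecewise continuousOn_const
    hQ.measurableSet
  have hvu : ∀ x ∈ Q, v x = u x := fun x hx => by simp [hv, hx]
  set k : E → E → ENNReal := fun x y => ‖v x - v ((1 / 2 : ℝ) • y + (1 / 2 : ℝ) • x)‖ₑ ^ 2 with hk
  have hkm : Measurable (Function.uncurry k) := by
    refine (Measurable.enorm ?_).pow_const 2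
    exact (hvm.comp measurable_fst).sub (hvm.comp (by fun_prop))
  have hkone : ∀ y ∈ Q, ∫⁻ x in Q, k x y ∂μ ≤ C * D := by
    intro y hy
    refine le_trans (le_of_eq ?_) (hone y hy)
    refine setLIntegral_congr_fun hQ.measurableSet fun x hx => ?_
    simp only [hk, hvu x hx, hvu _ (hmid x hx y hy)]
  -- The pairs (x, y) and (y, x) share their midpoint, so this is (s + t)² ≤ 2(s² + t²) through the
  -- value there.
  have hsum : ∀ x ∈ Q, ∀ y ∈ Q, ‖v x - v y‖ₑ ^ 2 ≤ 2 * (k x y + k y x) := by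
    intro x hx y hy
    simp only [hk]
    rw [add_comm ((1 / 2 : ℝ) • x) ((1 / 2 : ℝ) • y)]
    set m := v ((1 / 2 : ℝ) • y + (1 / 2 : ℝ) • x)
    rw [enorm_sq_eq_ofReal, enorm_sq_eq_ofReal, enorm_sq_eq_ofReal]
    rw [← ENNReal.ofReal_add (by positivity) (by positivity), ← ENNReal.ofReal_ofNat 2,
      ← ENNReal.ofReal_mul (by norm_num)]
    refine ENNReal.ofReal_le_ofReal ?_
    nlinarith [sq_nonneg (v x - m + (v y - m))]
  have htot : ∫⁻ y in Q, ∫⁻ x in Q, ‖v x - v y‖ₑ ^ 2 ∂μ ∂μ ≤ 4 * (C * D) * μ Q := by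
    have hA : ∫⁻ y in Q, ∫⁻ x in Q, k x y ∂μ ∂μ ≤ C * D * μ Q := by
      rw [← setLIntegral_const]
      exact setLIntegral_mono' hQ.measurableSet fun y hy => hkone y hy
    calc _ ≤ ∫⁻ y in Q, ∫⁻ x in Q, 2 * (k x y + k y x) ∂μ ∂μ :=
          setLIntegral_mono' hQ.measurableSet fun y hy =>
            setLIntegral_mono' hQ.measurableSet fun x hx => hsum x hx y hy
      _ = 4 * ∫⁻ y in Q, ∫⁻ x in Q, k x y ∂μ ∂μ := lintegral_lintegral_symm _ hkm
      _ ≤ 4 * (C * D * μ Q) := by gcongr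
      _ = _ := by rw [← mul_assoc]
  have hm : Measurable fun y => ∫⁻ x in Q, ‖v x - v y‖ₑ ^ 2 ∂μ := by
    refine Measurable.lintegral_prod_left' (f := fun q : E × E => ‖v q.1 - v q.2‖ₑ ^ 2) ?_
    exact (((hvm.comp measurable_fst).sub (hvm.comp measurable_snd)).enorm).pow_const 2
  -- The constant is a value v(y) at a point where the inner integral is at most its average over Q;
  -- the mean of u is not needed.
  obtain ⟨y, -, hy⟩ := exists_le_setLAverage hμ0 hμt hm.aemeasurable
  refine ⟨v y, ?_⟩
  rw [setLAverage_eq] at hy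
  calc _ = ∫⁻ x in Q, ‖v x - v y‖ₑ ^ 2 ∂μ :=
        setLIntegral_congr_fun hQ.measurableSet fun x hx => by simp only [hvu x hx]
    _ ≤ _ := hy
    _ ≤ (4 * (C * D) * μ Q) / μ Q := by gcongr
    _ = _ := by rw [ENNReal.mul_div_cancel_right hμ0 hμt, ← mul_assoc]

end Poincare

/-! ### Coordinates and the unit cylinder -/

/-- The transverse coordinates as a continuous linear map. -/
noncomputable def transverseL (d : ℕ) : Space d →L[ℝ] EuclideanSpace ℝ (Fin d) :=
  LinearMap.toContinuousLinearMap
    { toFun := transverse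
      map_add' := fun x y => by ext i; simp [transverse]
      map_smul' := fun c x => by ext i; simp [transverse] }

theorem transverseL_apply {d : ℕ} (x : Space d) : transverseL d x = transverse x := rfl

/-- The longitudinal coordinate as a continuous linear map. -/
noncomputable def axialL (d : ℕ) : Space d →L[ℝ] ℝ := EuclideanSpace.proj (Fin.last d)

theorem axialL_apply {d : ℕ} (x : Space d) : axialL d x = axial x := rfl

theorem continuous_axial {d : ℕ} : Continuous (axial (d := d)) := (axialL d).continuous

theorem continuous_transverse {d : ℕ} : Continuous (transverse (d := d)) :=
  (transverseL d).continuous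

theorem norm_sq_eq_transverse_add_axial {d : ℕ} (x : Space d) :
    ‖x‖ ^ 2 = ‖transverse x‖ ^ 2 + axial x ^ 2 := by
  rw [EuclideanSpace.norm_sq_eq, EuclideanSpace.norm_sq_eq, Fin.sum_univ_castSucc]
  simp [transverse, axial]

theorem abs_axial_le_norm {d : ℕ} (x : Space d) : |axial x| ≤ ‖x‖ := by
  refine abs_le_of_sq_le_sq ?_ (norm_nonneg x)
  nlinarith [norm_sq_eq_transverse_add_axial x, sq_nonneg ‖transverse x‖]

theorem norm_transverse_le_norm {d : ℕ} (x : Space d) : ‖transverse x‖ ≤ ‖x‖ := by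
  refine le_of_sq_le_sq ?_ (norm_nonneg x)
  nlinarith [norm_sq_eq_transverse_add_axial x, sq_nonneg (axial x)]

theorem norm_le_transverse_add_axial {d : ℕ} (x : Space d) :
    ‖x‖ ≤ ‖transverse x‖ + |axial x| := by
  refine le_of_sq_le_sq ?_ (by positivity)
  rw [norm_sq_eq_transverse_add_axial, ← sq_abs (axial x)]
  nlinarith [norm_nonneg (transverse x), abs_nonneg (axial x)]

theorem isOpen_unitCylinder (d : ℕ) : IsOpen (unitCylinder d) :=
  isOpen_lt continuous_transverse.norm continuous_const

theorem convex_unitCylinder (d : ℕ) : Convex ℝ (unitCylinder d) := by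
  have : unitCylinder d = transverseL d ⁻¹' Metric.ball 0 1 := by
    ext y
    simp [unitCylinder, transverseL_apply]
  rw [this]
  exact (convex_ball _ _).linear_preimage (transverseL d).toLinearMap

theorem norm_transverse_le_one_of_mem_closure {d : ℕ} {y : Space d}
    (hy : y ∈ closure (unitCylinder d)) : ‖transverse y‖ ≤ 1 :=
  closure_minimal (fun _ h => (show ‖transverse _‖ < 1 from h).le)
    (isClosed_le continuous_transverse.norm continuous_const) hy

theorem norm_transverse_eq_one_of_mem_frontier {d : ℕ} {y : Space d}
    (hy : y ∈ frontier (unitCylinder d)) : ‖transverse y‖ = 1 := by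
  refine le_antisymm (norm_transverse_le_one_of_mem_closure hy.1) ?_
  by_contra! h
  exact hy.2 (by rw [(isOpen_unitCylinder d).interior_eq]; exact h)

/-- The part of the unit cylinder between two cross sections. -/
def cylinderSlab (d : ℕ) (a b : ℝ) : Set (Space d) := unitCylinder d ∩ axial ⁻¹' Ioo a b

theorem isOpen_cylinderSlab (d : ℕ) (a b : ℝ) : IsOpen (cylinderSlab d a b) :=
  (isOpen_unitCylinder d).inter (isOpen_Ioo.preimage continuous_axial)

theorem convex_cylinderSlab (d : ℕ) (a b : ℝ) : Convex ℝ (cylinderSlab d a b) :=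
  (convex_unitCylinder d).inter ((convex_Ioo a b).linear_preimage (axialL d).toLinearMap)

theorem cylinderSlab_nonempty (d : ℕ) {a b : ℝ} (hab : a < b) :
    (cylinderSlab d a b).Nonempty := by
  refine ⟨sectionPoint 0 ((a + b) / 2), ?_, ?_⟩
  · have : transverse (sectionPoint (0 : EuclideanSpace ℝ (Fin d)) ((a + b) / 2)) = 0 := by
      ext i; simp [transverse, sectionPoint]
    simp [unitCylinder, this]
  · rw [mem_preimage, axial_sectionPoint]
    constructor <;> linarith

theorem unitCylinder_nonempty (d : ℕ) : (unitCylinder d).Nonempty :=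
  (cylinderSlab_nonempty d one_pos).mono inter_subset_left

theorem norm_sub_le_of_mem_cylinderSlab {d : ℕ} {a b : ℝ} {x y : Space d}
    (hx : x ∈ cylinderSlab d a b) (hy : y ∈ cylinderSlab d a b) : ‖x - y‖ ≤ 2 + (b - a) := by
  refine (norm_le_transverse_add_axial _).trans (add_le_add ?_ ?_)
  · rw [← transverseL_apply, map_sub]
    have h1 : ‖transverse x‖ < 1 := hx.1
    have h2 : ‖transverse y‖ < 1 := hy.1
    refine (norm_sub_le _ _).trans ?_
    rw [transverseL_apply, transverseL_apply]
    linarith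
  · rw [← axialL_apply, map_sub, axialL_apply, axialL_apply, abs_le]
    have := hx.2.1; have := hx.2.2; have := hy.2.1; have := hy.2.2
    constructor <;> linarith

theorem cylinderSlab_subset_ball (d : ℕ) {L : ℝ} :
    cylinderSlab d (-L) L ⊆ Metric.ball 0 (1 + L) := fun x hx => by
  have h1 : ‖transverse x‖ < 1 := hx.1
  have h2 : |axial x| < L := abs_lt.2 hx.2
  rw [mem_ball_zero_iff]
  linarith [norm_le_transverse_add_axial x]

open scoped Pointwise in
/-- The volume of a thin layer along the lateral boundary is proportional to its thickness. -/
theorem exists_volume_layer_le (d : ℕ) (L : ℝ) : ∃ C : ℝ, 0 ≤ C ∧ ∀ ε, 0 < ε → ε < 1 →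
    volume (cylinderSlab d (-L) L ∩ {y | 1 - ε < ‖transverse y‖ ^ 2}) ≤ ENNReal.ofReal (C * ε) := by
  set D := cylinderSlab d (-L) L with hD
  have hDt : volume D ≠ ⊤ :=
    (Metric.isBounded_ball.subset (cylinderSlab_subset_ball d)).measure_lt_top.ne
  refine ⟨(d + 1) * (volume D).toReal, by positivity, fun ε h0 h1 => ?_⟩
  set a := 1 - ε with ha
  have ha0 : 0 < a := by linarith
  have hsub : a • D ⊆ D := by
    rintro _ ⟨y, hy, rfl⟩
    have h2 : ‖transverse y‖ < 1 := hy.1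
    have h3 : |axial y| < L := abs_lt.2 hy.2
    refine ⟨?_, abs_lt.1 ?_⟩
    · change ‖transverseL d (a • y)‖ < 1
      rw [map_smul, norm_smul, Real.norm_eq_abs, abs_of_pos ha0, transverseL_apply]
      nlinarith [norm_nonneg (transverse y)]
    · change |axialL d (a • y)| < L
      rw [map_smul, smul_eq_mul, abs_mul, abs_of_pos ha0, axialL_apply]
      nlinarith [abs_nonneg (axial y)]
  -- A point az with z in D has squared transverse norm at most a² ≤ a. The layer thus lies between
  -- D and its dilate, whose volume is a^(d+1) times that of D.
  have hlayer : D ∩ {y | a < ‖transverse y‖ ^ 2} ⊆ D \ (a • D) := by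
    rintro y ⟨hy, hya⟩
    refine ⟨hy, ?_⟩
    rintro ⟨z, hz, rfl⟩
    have h2 : ‖transverse z‖ < 1 := hz.1
    have h3 : a < ‖transverseL d (a • z)‖ ^ 2 := hya
    rw [map_smul, norm_smul, Real.norm_eq_abs, abs_of_pos ha0, transverseL_apply] at h3
    have h4 := norm_nonneg (transverse z)
    have h5 : ‖transverse z‖ ^ 2 ≤ 1 := by nlinarith
    nlinarith [mul_le_mul_of_nonneg_left h5 (sq_nonneg a)]
  refine (measure_mono hlayer).trans ?_
  have hms : MeasurableSet (a • D) :=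
    ((isOpen_cylinderSlab d _ _).smul₀ ha0.ne').measurableSet
  have hat : volume (a • D) ≠ ⊤ := ((measure_mono hsub).trans_lt hDt.lt_top).ne
  rw [measure_sdiff hsub hms.nullMeasurableSet hat, Measure.addHaar_smul, finrank_euclideanSpace_fin,
    abs_of_pos (by positivity), ← ENNReal.ofReal_toReal hDt, ← ENNReal.ofReal_mul (by positivity),
    ← ENNReal.ofReal_sub _ (by positivity)]
  refine ENNReal.ofReal_le_ofReal ?_
  rw [ENNReal.toReal_ofReal ENNReal.toReal_nonneg]
  -- The elementary inequality of Bernoulli: 1 − (1 − ε)^(d+1) ≤ (d+1)ε.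
  have hb : 1 + ((d + 1 : ℕ) : ℝ) * (-ε) ≤ (1 + -ε) ^ (d + 1) :=
    one_add_mul_le_pow (by linarith) _
  rw [← sub_eq_add_neg, ← ha] at hb
  push_cast at hb
  nlinarith [ENNReal.toReal_nonneg (a := volume D)]

/-! ### Change of variables -/

theorem exists_abs_det_le {E : Type*} [NormedAddCommGroup E] [NormedSpace ℝ E]
    [FiniteDimensional ℝ E] (K : ℝ) :
    ∃ C : ℝ, ∀ A : E →L[ℝ] E, ‖A‖ ≤ K → |A.det| ≤ C := by
  obtain ⟨C, hC⟩ := (isCompact_closedBall (0 : E →L[ℝ] E) K).exists_bound_of_continuousOn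
    (f := fun A => A.det) ContinuousLinearMap.continuous_det.continuousOn
  exact ⟨C, fun A hA => hC A (by simpa using hA)⟩

/-- The Jacobian is bounded by compactness of a ball of operators. The constant is fixed before the
map and the set, which makes all slab estimates uniform in the position of the slab. -/
theorem exists_lintegral_image_le (E : Type*) [NormedAddCommGroup E] [NormedSpace ℝ E]
    [FiniteDimensional ℝ E] [MeasurableSpace E] [BorelSpace E] (μ : Measure E)
    [μ.IsAddHaarMeasure] (K : ℝ) :
    ∃ C : ENNReal, C ≠ ⊤ ∧ ∀ (F : E → E) (s : Set E), MeasurableSet s → InjOn F s →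
      (∀ x ∈ s, DifferentiableAt ℝ F x ∧ ‖fderiv ℝ F x‖ ≤ K) → ∀ g : E → ENNReal,
      ∫⁻ x in F '' s, g x ∂μ ≤ C * ∫⁻ x in s, g (F x) ∂μ := by
  obtain ⟨C, hC⟩ := exists_abs_det_le (E := E) K
  refine ⟨ENNReal.ofReal C, ENNReal.ofReal_ne_top, fun F s hs hinj hF g => ?_⟩
  rw [lintegral_image_eq_lintegral_abs_det_fderiv_mul μ hs
    (fun x hx => (hF x hx).1.hasFDerivAt.hasFDerivWithinAt) hinj,
    ← lintegral_const_mul' _ _ ENNReal.ofReal_ne_top]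
  refine setLIntegral_mono' hs fun x hx => ?_
  gcongr
  exact hC _ (hF x hx).2

/-! ### Transfer of volume and Poincaré estimates from the cylinder to the nozzle. -/

namespace IsStraightening

variable {d : ℕ} {Ω : Set (Space d)} {α K : ℝ} {T S : Space d → Space d}

theorem axial_apply (h : IsStraightening Ω α K T S) {x : Space d} (hx : x ∈ Ω) :
    axial (T x) = axial x := by
  have : T x ∈ unitCylinder d ∩ {y | axial y = axial x} := by
    rw [← h.image_section]; exact ⟨x, ⟨hx, rfl⟩, rfl⟩
  exact this.2

theorem mapsTo (h : IsStraightening Ω α K T S) : MapsTo T Ω (unitCylinder d) := fun x hx => by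
  have : T x ∈ unitCylinder d ∩ {y | axial y = axial x} := by
    rw [← h.image_section]; exact ⟨x, ⟨hx, rfl⟩, rfl⟩
  exact this.1

theorem inv_apply (h : IsStraightening Ω α K T S) {x : Space d} (hx : x ∈ Ω) : S (T x) = x :=
  h.invOn.1 (subset_closure hx)

theorem apply_inv (h : IsStraightening Ω α K T S) {y : Space d} (hy : y ∈ unitCylinder d) :
    T (S y) = y :=
  h.invOn.2 (subset_closure hy)

theorem mapsTo_inv (h : IsStraightening Ω α K T S) : MapsTo S (unitCylinder d) Ω := fun y hy => by
  have : y ∈ T '' (Ω ∩ {x | axial x = axial y}) := by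
    rw [h.image_section]; exact ⟨hy, rfl⟩
  obtain ⟨x, ⟨hx, -⟩, rfl⟩ := this
  rwa [h.inv_apply hx]

theorem axial_inv_apply (h : IsStraightening Ω α K T S) {y : Space d} (hy : y ∈ unitCylinder d) :
    axial (S y) = axial y := by
  rw [← h.axial_apply (h.mapsTo_inv hy), h.apply_inv hy]

theorem differentiableAt (h : IsStraightening Ω α K T S) (hΩ : IsOpen Ω) {x : Space d}
    (hx : x ∈ Ω) : DifferentiableAt ℝ T x :=
  (h.regular.contDiffOn.differentiableOn (by simp)).differentiableAt (hΩ.mem_nhds hx)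

theorem differentiableAt_inv (h : IsStraightening Ω α K T S) {y : Space d}
    (hy : y ∈ unitCylinder d) : DifferentiableAt ℝ S y :=
  (h.regular_inv.contDiffOn.differentiableOn (by simp)).differentiableAt
    ((isOpen_unitCylinder d).mem_nhds hy)

theorem nonneg (h : IsStraightening Ω α K T S) : 0 ≤ K := by
  obtain ⟨y, hy⟩ := unitCylinder_nonempty d
  exact (norm_nonneg _).trans (h.regular_inv.bound_one y hy)

theorem image_slab (h : IsStraightening Ω α K T S) (s : Set ℝ) :
    T '' (Ω ∩ axial ⁻¹' s) = unitCylinder d ∩ axial ⁻¹' s := by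
  refine Subset.antisymm ?_ fun y hy => ⟨S y, ⟨h.mapsTo_inv hy.1, ?_⟩, h.apply_inv hy.1⟩
  · rintro _ ⟨x, hx, rfl⟩
    exact ⟨h.mapsTo hx.1, by rw [mem_preimage, h.axial_apply hx.1]; exact hx.2⟩
  · rw [mem_preimage, h.axial_inv_apply hy.1]; exact hy.2

theorem image_inv (h : IsStraightening Ω α K T S) {A : Set (Space d)} (hA : A ⊆ unitCylinder d) :
    S '' A = Ω ∩ T ⁻¹' A := by
  refine Subset.antisymm ?_ fun x hx => ⟨T x, hx.2, h.inv_apply hx.1⟩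
  rintro _ ⟨y, hy, rfl⟩
  exact ⟨h.mapsTo_inv (hA hy), by rwa [mem_preimage, h.apply_inv (hA hy)]⟩

theorem slab_eq (h : IsStraightening Ω α K T S) (s : Set ℝ) :
    Ω ∩ T ⁻¹' (unitCylinder d ∩ axial ⁻¹' s) = Ω ∩ axial ⁻¹' s := by
  ext x
  refine and_congr_right fun hx => ?_
  simp only [mem_preimage, mem_inter_iff, h.axial_apply hx, h.mapsTo hx, true_and]

theorem exists_lintegral_le (h : IsStraightening Ω α K T S) :
    ∃ C : ENNReal, C ≠ ⊤ ∧ ∀ A ⊆ unitCylinder d, MeasurableSet A → ∀ g : Space d → ENNReal,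
      ∫⁻ x in Ω ∩ T ⁻¹' A, g x ≤ C * ∫⁻ y in A, g (S y) := by
  obtain ⟨C, hC, H⟩ := exists_lintegral_image_le (Space d) volume K
  refine ⟨C, hC, fun A hA hm g => ?_⟩
  rw [← h.image_inv hA]
  exact H S A hm (fun x hx y hy hxy => by rw [← h.apply_inv (hA hx), hxy, h.apply_inv (hA hy)])
    (fun x hx => ⟨h.differentiableAt_inv (hA hx), h.regular_inv.bound_one x (hA hx)⟩) g

theorem exists_lintegral_slab_le (h : IsStraightening Ω α K T S) (hΩ : IsOpen Ω) :
    ∃ C : ENNReal, C ≠ ⊤ ∧ ∀ a b, ∀ g : Space d → ENNReal,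
      ∫⁻ y in cylinderSlab d a b, g y ≤ C * ∫⁻ x in Ω ∩ axial ⁻¹' Ioo a b, g (T x) := by
  obtain ⟨C, hC, H⟩ := exists_lintegral_image_le (Space d) volume K
  refine ⟨C, hC, fun a b g => ?_⟩
  rw [cylinderSlab, ← h.image_slab]
  exact H T _ (hΩ.inter (isOpen_Ioo.preimage continuous_axial)).measurableSet
    (fun x hx y hy hxy => by rw [← h.inv_apply hx.1, hxy, h.inv_apply hy.1])
    (fun x hx => ⟨h.differentiableAt hΩ hx.1, h.regular.bound_one x hx.1⟩) g

/-- The straightened slab is put crudely into a ball of radius 1 + L. Linear growth would be the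
true order, but any polynomial is beaten by the geometric decay used later. -/
theorem exists_volume_slab_le (h : IsStraightening Ω α K T S) :
    ∃ C : ℝ, 0 ≤ C ∧ ∀ L : ℝ, 0 ≤ L →
      volume (Ω ∩ axial ⁻¹' Ioo (-L) L) ≤ ENNReal.ofReal (C * (1 + L) ^ (d + 1)) := by
  obtain ⟨C, hC, H⟩ := h.exists_lintegral_le
  set V := volume (Metric.ball (0 : Space d) 1) with hV
  have hVt : V ≠ ⊤ := measure_ball_lt_top.ne
  refine ⟨C.toReal * V.toReal, by positivity, fun L hL => ?_⟩
  have h1 := H (cylinderSlab d (-L) L) inter_subset_left (isOpen_cylinderSlab d _ _).measurableSet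
    fun _ => 1
  rw [cylinderSlab, h.slab_eq, setLIntegral_const, setLIntegral_const, one_mul, one_mul] at h1
  refine h1.trans ((mul_le_mul_right (measure_mono (cylinderSlab_subset_ball d)) C).trans ?_)
  rw [Measure.addHaar_ball_of_pos _ _ (by linarith), finrank_euclideanSpace_fin,
    ENNReal.ofReal_mul (by positivity), ENNReal.ofReal_mul (by positivity),
    ENNReal.ofReal_toReal hC, ENNReal.ofReal_toReal hVt, ← hV, mul_assoc]
  exact mul_le_mul_right (mul_comm _ _).le _

theorem exists_volume_layer_le (h : IsStraightening Ω α K T S) (L : ℝ) :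
    ∃ C : ℝ, 0 ≤ C ∧ ∀ ε, 0 < ε → ε < 1 →
      volume (Ω ∩ T ⁻¹' (cylinderSlab d (-L) L ∩ {y | 1 - ε < ‖transverse y‖ ^ 2})) ≤
        ENNReal.ofReal (C * ε) := by
  obtain ⟨C, hC, H⟩ := h.exists_lintegral_le
  obtain ⟨C', hC', H'⟩ := _root_.exists_volume_layer_le d L
  refine ⟨C.toReal * C', by positivity, fun ε h0 h1 => ?_⟩
  have h2 := H (cylinderSlab d (-L) L ∩ {y | 1 - ε < ‖transverse y‖ ^ 2})
    (inter_subset_left.trans inter_subset_left) ((isOpen_cylinderSlab d _ _).inter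
      (isOpen_lt continuous_const (continuous_transverse.norm.pow 2))).measurableSet fun _ => 1
  rw [setLIntegral_const, setLIntegral_const, one_mul, one_mul] at h2
  refine h2.trans ((mul_le_mul_right (H' ε h0 h1) C).trans ?_)
  rw [mul_assoc, ENNReal.ofReal_mul ENNReal.toReal_nonneg, ENNReal.ofReal_toReal hC]

/-- Poincaré's inequality on slabs of unit length, with a uniform constant. -/
theorem exists_poincare (h : IsStraightening Ω α K T S) (hΩ : IsOpen Ω) :
    ∃ C : ENNReal, C ≠ ⊤ ∧ ∀ ψ : Space d → ℝ, ContDiffOn ℝ 1 ψ Ω → ∀ a : ℝ, ∃ c : ℝ,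
      ∫⁻ x in Ω ∩ axial ⁻¹' Ioo a (a + 1), ‖ψ x - c‖ₑ ^ 2 ≤
        C * ∫⁻ x in Ω ∩ axial ⁻¹' Ioo a (a + 1), ‖fderiv ℝ ψ x‖ₑ ^ 2 := by
  obtain ⟨C₁, hC₁, H₁⟩ := h.exists_lintegral_le
  obtain ⟨C₂, hC₂, H₂⟩ := h.exists_lintegral_slab_le hΩ
  set P : ENNReal := 4 * (ENNReal.ofReal ((3 : ℝ) ^ 2 / 2) * 2 ^ Module.finrank ℝ (Space d)) with hP
  have hPt : P ≠ ⊤ := by finiteness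
  refine ⟨C₁ * (P * (ENNReal.ofReal K ^ 2 * C₂)), by finiteness, fun ψ hψ a => ?_⟩
  set Q := cylinderSlab d a (a + 1)
  have hQC : Q ⊆ unitCylinder d := inter_subset_left
  have hQo := isOpen_cylinderSlab d a (a + 1)
  -- Slabs of the nozzle need not be convex, so Poincaré's inequality is applied on the straight
  -- slab, of diameter at most 2 + 1 = 3, and both integrals are transported back.
  have hu : ContDiffOn ℝ 1 (fun y => ψ (S y)) Q :=
    hψ.comp ((h.regular_inv.contDiffOn.of_le (by norm_num)).mono hQC)
      fun y hy => h.mapsTo_inv (hQC hy)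
  obtain ⟨c, hc⟩ := exists_lintegral_sub_sq_le volume hQo (convex_cylinderSlab d a (a + 1))
    (cylinderSlab_nonempty d (by linarith)) (R := 3)
    (fun x hx y hy => (norm_sub_le_of_mem_cylinderSlab hx hy).trans (by linarith)) hu
  refine ⟨c, ?_⟩
  have hset : Ω ∩ axial ⁻¹' Ioo a (a + 1) = Ω ∩ T ⁻¹' Q := (h.slab_eq _).symm
  calc _ ≤ C₁ * ∫⁻ y in Q, ‖ψ (S y) - c‖ₑ ^ 2 := by
        rw [hset]; exact H₁ Q hQC hQo.measurableSet _
    _ ≤ C₁ * (P * ∫⁻ y in Q, ‖fderiv ℝ (fun y => ψ (S y)) y‖ₑ ^ 2) := by gcongr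
    _ ≤ C₁ * (P * ∫⁻ y in Q, ENNReal.ofReal K ^ 2 * ‖fderiv ℝ ψ (S y)‖ₑ ^ 2) := by
        refine mul_le_mul_right (mul_le_mul_right
          (setLIntegral_mono' hQo.measurableSet fun y hy => ?_) _) _
        have hψd : DifferentiableAt ℝ ψ (S y) := (hψ.differentiableOn (by simp)).differentiableAt
          (hΩ.mem_nhds (h.mapsTo_inv (hQC hy)))
        have e : fderiv ℝ (fun y => ψ (S y)) y = (fderiv ℝ ψ (S y)).comp (fderiv ℝ S y) :=
          fderiv_comp y hψd (h.differentiableAt_inv (hQC hy))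
        rw [e, ← mul_pow, mul_comm, ← ofReal_norm, ← ofReal_norm,
          ← ENNReal.ofReal_mul (norm_nonneg _)]
        refine pow_le_pow_left' (ENNReal.ofReal_le_ofReal ?_) 2
        refine (ContinuousLinearMap.opNorm_comp_le _ _).trans ?_
        gcongr
        exact h.regular_inv.bound_one y (hQC hy)
    _ = C₁ * (P * (ENNReal.ofReal K ^ 2 * ∫⁻ y in Q, ‖fderiv ℝ ψ (S y)‖ₑ ^ 2)) := by
        rw [lintegral_const_mul' _ _ (by finiteness)]
    _ ≤ C₁ * (P * (ENNReal.ofReal K ^ 2 * (C₂ *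
          ∫⁻ x in Ω ∩ axial ⁻¹' Ioo a (a + 1), ‖fderiv ℝ ψ (S (T x))‖ₑ ^ 2))) := by
        gcongr
        exact H₂ a (a + 1) _
    _ = C₁ * (P * (ENNReal.ofReal K ^ 2 * (C₂ *
          ∫⁻ x in Ω ∩ axial ⁻¹' Ioo a (a + 1), ‖fderiv ℝ ψ x‖ₑ ^ 2))) := by
        congr 4
        refine setLIntegral_congr_fun
          (hΩ.inter (isOpen_Ioo.preimage continuous_axial)).measurableSet fun x hx => ?_
        simp only [h.inv_apply hx.1]
    _ = _ := by ring

end IsStraightening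

/-! ### The no-flow condition in straightened coordinates -/

theorem tendsto_clm_apply {ι E F : Type*} [NormedAddCommGroup E] [NormedSpace ℝ E]
    [NormedAddCommGroup F] [NormedSpace ℝ F] {l : Filter ι} {A : ι → E →L[ℝ] F} {A₀ : E →L[ℝ] F}
    {v : ι → E} {v₀ : E} (hA : Tendsto A l (𝓝 A₀)) (hv : Tendsto v l (𝓝 v₀)) :
    Tendsto (fun i => A i (v i)) l (𝓝 (A₀ v₀)) :=
  (isBoundedBilinearMap_apply.continuous.tendsto (A₀, v₀)).comp (hA.prodMk_nhds hv)

/-- The sign passes to the bounding hyperplane by pushing w slightly inwards, and the hyperplane is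
symmetric under w ↦ −w. -/
theorem eq_zero_of_nonpos_of_inner_neg {E : Type*} [NormedAddCommGroup E] [InnerProductSpace ℝ E]
    (l : E →ₗ[ℝ] ℝ) {ν : E} (hν : ‖ν‖ = 1) (hl : ∀ w, inner ℝ w ν < 0 → l w ≤ 0) {w : E}
    (hw : inner ℝ w ν = 0) : l w = 0 := by
  have key : ∀ w, inner ℝ w ν = 0 → l w ≤ 0 := fun w hw => by
    have h1 : ∀ t > 0, l w - t * l ν ≤ 0 := fun t ht => by
      have := hl (w - t • ν) (by
        rw [inner_sub_left, hw, real_inner_smul_left, real_inner_self_eq_norm_sq, hν]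
        linarith)
      simpa using this
    by_contra! h0
    -- This push is small enough to cost at most half of l w.
    have h2 := h1 (l w / (2 * (|l ν| + 1))) (by positivity)
    have h3 : l w / (2 * (|l ν| + 1)) * l ν ≤ l w / (2 * (|l ν| + 1)) * (|l ν| + 1) := by
      gcongr
      linarith [le_abs_self (l ν)]
    have h4 : l w / (2 * (|l ν| + 1)) * (|l ν| + 1) = l w / 2 := by field_simp
    linarith
  refine le_antisymm (key w hw) ?_
  have := key (-w) (by rw [inner_neg_left, hw, neg_zero])
  rw [map_neg] at this
  linarith

theorem IsOuterUnitNormal.exists_forall_add_smul_mem {d : ℕ} {Ω : Set (Space d)} {x ν : Space d}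
    (hν : IsOuterUnitNormal Ω x ν) {w : Space d} (hw : inner ℝ w ν < 0) :
    ∃ s₀ : ℝ, 0 < s₀ ∧ ∀ s ∈ Ioo 0 s₀, x + s • w ∈ Ω := by
  have hw0 : 0 < ‖w‖ := by
    rw [norm_pos_iff]
    rintro rfl
    simp at hw
  -- Half of the inward slope of w, so that w lies strictly inside the cone.
  obtain ⟨r, hr, H⟩ := hν.2 (-inner ℝ w ν / (2 * ‖w‖)) (div_pos (by linarith) (by positivity))
  refine ⟨r / ‖w‖, by positivity, fun s hs => (H _ ?_).1 ?_⟩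
  · rw [Metric.mem_ball, dist_eq_norm, add_sub_cancel_left, norm_smul, Real.norm_eq_abs,
      abs_of_pos hs.1]
    exact (lt_div_iff₀ hw0).1 hs.2
  · rw [add_sub_cancel_left, norm_smul, Real.norm_eq_abs, abs_of_pos hs.1, real_inner_smul_left]
    have : -(-inner ℝ w ν / (2 * ‖w‖)) * (s * ‖w‖) = s * inner ℝ w ν / 2 := by field_simp
    rw [this]
    nlinarith [hs.1]

theorem hasDerivAt_norm_sq_transverse_comp {d : ℕ} {γ : ℝ → Space d} {γ' : Space d} {s : ℝ}
    (hγ : HasDerivAt γ γ' s) :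
    HasDerivAt (fun s => ‖transverse (γ s)‖ ^ 2)
      (2 * inner ℝ (transverse (γ s)) (transverse γ')) s :=
  ((transverseL d).hasFDerivAt.comp_hasDerivAt s hγ).norm_sq

/-- Compactness: points violating the bound with ε → 0 stay bounded, since |y_n| ≤ L, and accumulate
at a lateral boundary point, where g tends to 0. -/
theorem exists_forall_near_frontier_le {d : ℕ} {g : Space d → ℝ}
    (hg : ∀ y₀ ∈ frontier (unitCylinder d), Tendsto g (𝓝[unitCylinder d] y₀) (𝓝 0)) (L : ℝ)
    {δ : ℝ} (hδ : 0 < δ) :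
    ∃ ε > 0, ∀ y ∈ unitCylinder d, |axial y| ≤ L → 1 - ε < ‖transverse y‖ ^ 2 → |g y| ≤ δ := by
  by_contra! H
  choose y hyC hyL hy1 hyδ using fun n : ℕ => H (1 / ((n : ℝ) + 1)) Nat.one_div_pos_of_nat
  have hyb : ∀ n, y n ∈ Metric.closedBall (0 : Space d) (1 + L) := fun n => by
    rw [mem_closedBall_zero_iff]
    have : ‖transverse (y n)‖ < 1 := hyC n
    linarith [norm_le_transverse_add_axial (y n), hyL n]
  obtain ⟨y₀, -, k, hk, hlim⟩ := (isCompact_closedBall _ _).tendsto_subseq hyb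
  have h1 : 1 ≤ ‖transverse y₀‖ ^ 2 := by
    have e1 : Tendsto (fun n => ‖transverse (y (k n))‖ ^ 2) atTop (𝓝 (‖transverse y₀‖ ^ 2)) :=
      (((continuous_transverse.tendsto y₀).comp hlim).norm).pow 2
    have e2 : Tendsto (fun n : ℕ => 1 - 1 / ((k n : ℝ) + 1)) atTop (𝓝 1) := by
      simpa using (tendsto_one_div_add_atTop_nhds_zero_nat.comp hk.tendsto_atTop).const_sub (1 : ℝ)
    exact le_of_tendsto_of_tendsto' e2 e1 fun n => (hy1 (k n)).le
  have hfr : y₀ ∈ frontier (unitCylinder d) := by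
    refine ⟨mem_closure_of_tendsto hlim (Eventually.of_forall fun n => hyC _), ?_⟩
    rw [(isOpen_unitCylinder d).interior_eq]
    intro h2
    have h3 : ‖transverse y₀‖ < 1 := h2
    nlinarith [norm_nonneg (transverse y₀)]
  have h2 := (hg y₀ hfr).comp (tendsto_nhdsWithin_iff.2 ⟨hlim, Eventually.of_forall fun n => hyC _⟩)
  have h3 := h2.abs
  rw [abs_zero] at h3
  obtain ⟨n, hn⟩ := (h3.eventually (gt_mem_nhds hδ)).exists
  exact (hyδ (k n)).not_gt hn

namespace IsStraightening

variable {d : ℕ} {Ω : Set (Space d)} {α K : ℝ} {T S : Space d → Space d}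

/-- The derivative of T, read on the convex cylinder, is Lipschitz by the bounds on D²T and DS, so
the Cauchy criterion gives boundary values. -/
theorem exists_tendsto_fderiv (h : IsStraightening Ω α K T S) (hΩ : IsOpen Ω) {y₀ : Space d}
    (hy₀ : y₀ ∈ closure (unitCylinder d)) :
    ∃ M, Tendsto (fun y => fderiv ℝ T (S y)) (𝓝[unitCylinder d] y₀) (𝓝 M) := by
  have hd : ∀ y ∈ unitCylinder d, HasFDerivWithinAt (fun y => fderiv ℝ T (S y))
      ((fderiv ℝ (fderiv ℝ T) (S y)).comp (fderiv ℝ S y)) (unitCylinder d) y := fun y hy => by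
    have h1 : DifferentiableAt ℝ (fderiv ℝ T) (S y) :=
      ((h.regular.contDiffOn.contDiffAt (hΩ.mem_nhds (h.mapsTo_inv hy))).fderiv_right
        (m := 1) (by norm_num)).differentiableAt (by simp)
    exact (h1.hasFDerivAt.comp y (h.differentiableAt_inv hy).hasFDerivAt).hasFDerivWithinAt
  have hK := h.nonneg
  have hlip : LipschitzOnWith (Real.toNNReal (K * K)) (fun y => fderiv ℝ T (S y))
      (unitCylinder d) := by
    refine (convex_unitCylinder d).lipschitzOnWith_of_nnnorm_hasFDerivWithin_le hd fun y hy => ?_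
    rw [← NNReal.coe_le_coe, coe_nnnorm, Real.coe_toNNReal _ (by positivity)]
    refine (ContinuousLinearMap.opNorm_comp_le _ _).trans ?_
    gcongr
    · exact h.regular.bound_two _ (h.mapsTo_inv hy)
    · exact h.regular_inv.bound_one y hy
  have : NeBot (𝓝[unitCylinder d] y₀) := mem_closure_iff_nhdsWithin_neBot.1 hy₀
  have hc : Cauchy (𝓝[unitCylinder d] y₀) := cauchy_nhds.mono nhdsWithin_le_nhds
  exact CompleteSpace.complete (hc.map_of_le hlip.uniformContinuousOn inf_le_right)

/-- Start at a boundary point, where |T'|² = 1, and move in a direction w pointing into Ω. A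
positive limit would make |T'|² increase beyond 1, although T maps Ω into the open cylinder. -/
theorem inner_limit_nonpos (h : IsStraightening Ω α K T S) (hΩ : IsOpen Ω) {x₀ ν : Space d}
    (hx₀ : x₀ ∈ frontier Ω) (hν : IsOuterUnitNormal Ω x₀ ν) {M : Space d →L[ℝ] Space d}
    (hM : Tendsto (fun y => fderiv ℝ T (S y)) (𝓝[unitCylinder d] (T x₀)) (𝓝 M)) {w : Space d}
    (hw : inner ℝ w ν < 0) : inner ℝ (transverse (T x₀)) (transverse (M w)) ≤ 0 := by
  by_contra! hpos
  obtain ⟨s₀, hs₀, hmem⟩ := hν.exists_forall_add_smul_mem hw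
  have hx₀c : x₀ ∈ closure Ω := hx₀.1
  have hy₀ : ‖transverse (T x₀)‖ = 1 :=
    norm_transverse_eq_one_of_mem_frontier (h.image_frontier ▸ mem_image_of_mem T hx₀)
  have hγ : ∀ s : ℝ, HasDerivAt (fun s : ℝ => x₀ + s • w) w s := fun s => by
    simpa using ((hasDerivAt_id s).smul_const w).const_add x₀
  have hγc : Continuous fun s : ℝ => x₀ + s • w := by fun_prop
  set r : ℝ → ℝ := fun s => ‖transverse (T (x₀ + s • w))‖ ^ 2 with hr
  have hr' : ∀ s ∈ Ioo 0 s₀, HasDerivAt r (2 * inner ℝ (transverse (T (x₀ + s • w)))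
      (transverse (fderiv ℝ T (x₀ + s • w) w))) s := fun s hs =>
    hasDerivAt_norm_sq_transverse_comp
      ((h.differentiableAt hΩ (hmem s hs)).hasFDerivAt.comp_hasDerivAt s (hγ s))
  have hev : ∀ᶠ s in 𝓝[>] (0 : ℝ), x₀ + s • w ∈ Ω := by
    filter_upwards [Ioo_mem_nhdsGT hs₀] with s hs using hmem s hs
  have hγ0 : Tendsto (fun s : ℝ => x₀ + s • w) (𝓝[>] 0) (𝓝[Ω] x₀) := by
    refine tendsto_nhdsWithin_iff.2 ⟨?_, hev⟩
    have := (hγc.tendsto 0).mono_left (nhdsWithin_le_nhds (s := Ioi 0))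
    simpa using this
  have hT0 : Tendsto (fun s : ℝ => T (x₀ + s • w)) (𝓝[>] 0) (𝓝[unitCylinder d] (T x₀)) :=
    tendsto_nhdsWithin_iff.2
      ⟨((h.regular.continuousOn x₀ hx₀c).mono_left (nhdsWithin_mono _ subset_closure)).comp hγ0,
      hev.mono fun s hs => h.mapsTo hs⟩
  have hD0 : Tendsto (fun s : ℝ => fderiv ℝ T (x₀ + s • w)) (𝓝[>] 0) (𝓝 M) := by
    refine (hM.comp hT0).congr' ?_
    filter_upwards [hev] with s hs
    simp only [Function.comp, h.inv_apply hs]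
  have hlim : Tendsto (fun s : ℝ => 2 * inner ℝ (transverse (T (x₀ + s • w)))
      (transverse (fderiv ℝ T (x₀ + s • w) w))) (𝓝[>] 0)
      (𝓝 (2 * inner ℝ (transverse (T x₀)) (transverse (M w)))) := by
    refine Tendsto.const_mul 2 (Tendsto.inner ?_ ?_)
    · exact (continuous_transverse.tendsto _).comp (hT0.mono_right nhdsWithin_le_nhds)
    · exact (continuous_transverse.tendsto _).comp (tendsto_clm_apply hD0 tendsto_const_nhds)
  obtain ⟨s₁, hs₁, H⟩ := mem_nhdsGT_iff_exists_Ioo_subset.1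
    ((hlim.eventually (lt_mem_nhds (mul_pos two_pos hpos))))
  have hs₁0 : 0 < s₁ := hs₁
  set b := min s₀ s₁ / 2 with hb
  have hb0 : 0 < b := by positivity
  have hbs₀ : b < s₀ := by linarith [min_le_left s₀ s₁]
  have hbs₁ : b < s₁ := by linarith [min_le_right s₀ s₁]
  have hrc : ContinuousOn r (Icc 0 b) := by
    refine (continuous_transverse.comp_continuousOn (h.regular.continuousOn.comp
      hγc.continuousOn ?_)).norm.pow 2
    intro s hs
    rcases hs.1.eq_or_lt with rfl | h0
    · simpa using hx₀c
    · exact subset_closure (hmem s ⟨h0, hs.2.trans_lt hbs₀⟩)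
  have hmono : StrictMonoOn r (Icc 0 b) := by
    refine strictMonoOn_of_deriv_pos (convex_Icc 0 b) hrc fun s hs => ?_
    rw [interior_Icc] at hs
    rw [(hr' s ⟨hs.1, hs.2.trans hbs₀⟩).deriv]
    exact H ⟨hs.1, hs.2.trans hbs₁⟩
  have h1 := hmono (left_mem_Icc.2 hb0.le) (right_mem_Icc.2 hb0.le) hb0
  have h2 : r 0 = 1 := by simp [hr, hy₀]
  have h3 : ‖transverse (T (x₀ + b • w))‖ < 1 := h.mapsTo (hmem b ⟨hb0, hbs₀⟩)
  have h4 : r b < 1 := by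
    simp only [hr]
    nlinarith [norm_nonneg (transverse (T (x₀ + b • w)))]
  linarith

/-- The limiting functional w ↦ ⟨T', (Mw)'⟩ is nonpositive on inward directions, hence vanishes on
the hyperplane orthogonal to ν, and v lies in that hyperplane. -/
theorem tendsto_inner_transverse (h : IsStraightening Ω α K T S) (hΩ : IsOpen Ω)
    {v : Space d → Space d} (hv : ContinuousOn v (closure Ω))
    (hn : ∀ x ∈ frontier Ω, ∃ ν, IsOuterUnitNormal Ω x ν ∧ inner ℝ (v x) ν = 0) {y₀ : Space d}
    (hy₀ : y₀ ∈ frontier (unitCylinder d)) :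
    Tendsto (fun y => inner ℝ (transverse y) (transverse (fderiv ℝ T (S y) (v (S y)))))
      (𝓝[unitCylinder d] y₀) (𝓝 0) := by
  obtain ⟨M, hM⟩ := h.exists_tendsto_fderiv hΩ hy₀.1
  rw [← h.image_frontier] at hy₀
  obtain ⟨x₀, hx₀, rfl⟩ := hy₀
  obtain ⟨ν, hν, hvν⟩ := hn x₀ hx₀
  have hSx : S (T x₀) = x₀ := h.invOn.1 hx₀.1
  have hS : Tendsto S (𝓝[unitCylinder d] (T x₀)) (𝓝[closure Ω] x₀) := by
    refine tendsto_nhdsWithin_iff.2 ⟨?_, ?_⟩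
    · have := (h.regular_inv.continuousOn (T x₀) (h.bijOn.mapsTo hx₀.1)).mono_left
        (nhdsWithin_mono _ subset_closure)
      rwa [hSx] at this
    · filter_upwards [self_mem_nhdsWithin] with y hy using subset_closure (h.mapsTo_inv hy)
  have hvS := (hv x₀ hx₀.1).tendsto.comp hS
  have hlim : Tendsto (fun y => inner ℝ (transverse y) (transverse (fderiv ℝ T (S y) (v (S y)))))
      (𝓝[unitCylinder d] (T x₀)) (𝓝 (inner ℝ (transverse (T x₀)) (transverse (M (v x₀))))) := by
    refine Tendsto.inner ?_ ?_
    · exact (continuous_transverse.tendsto _).mono_left nhdsWithin_le_nhds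
    · exact (continuous_transverse.tendsto _).comp (tendsto_clm_apply hM hvS)
  have hzero := eq_zero_of_nonpos_of_inner_neg
    ((innerSL ℝ (transverse (T x₀))).comp ((transverseL d).comp M)).toLinearMap hν.1
    (fun w hw => h.inner_limit_nonpos hΩ hx₀ hν hM hw) hvν
  have hzero' : inner ℝ (transverse (T x₀)) (transverse (M (v x₀))) = 0 := hzero
  rwa [hzero'] at hlim

/-- The component of a tangential field across the level sets of `|T'|²` is small near the
boundary, uniformly on bounded portions of the nozzle. -/
theorem exists_forall_layer_le (h : IsStraightening Ω α K T S) (hΩ : IsOpen Ω)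
    {v : Space d → Space d} (hv : ContinuousOn v (closure Ω))
    (hn : ∀ x ∈ frontier Ω, ∃ ν, IsOuterUnitNormal Ω x ν ∧ inner ℝ (v x) ν = 0) (L : ℝ)
    {δ : ℝ} (hδ : 0 < δ) :
    ∃ ε > 0, ∀ x ∈ Ω, |axial x| ≤ L → 1 - ε < ‖transverse (T x)‖ ^ 2 →
      |inner ℝ (transverse (T x)) (transverse (fderiv ℝ T x (v x)))| ≤ δ := by
  obtain ⟨ε, hε, H⟩ := exists_forall_near_frontier_le
    (fun y₀ hy₀ => h.tendsto_inner_transverse hΩ hv hn hy₀) L hδ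
  refine ⟨ε, hε, fun x hx hL h1 => ?_⟩
  have := H (T x) (h.mapsTo hx) (by rwa [h.axial_apply hx]) h1
  rwa [h.inv_apply hx] at this

end IsStraightening

/-! ### The weak formulation -/

theorem deriv_smoothTransition_eq_zero_of_nonpos {t : ℝ} (ht : t ≤ 0) :
    deriv Real.smoothTransition t = 0 := by
  refine IsLocalMin.deriv_eq_zero (Eventually.of_forall fun s => ?_)
  rw [Real.smoothTransition.zero_of_nonpos ht]
  exact Real.smoothTransition.nonneg s

theorem deriv_smoothTransition_eq_zero_of_one_le {t : ℝ} (ht : 1 ≤ t) :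
    deriv Real.smoothTransition t = 0 := by
  refine IsLocalMax.deriv_eq_zero (Eventually.of_forall fun s => ?_)
  rw [Real.smoothTransition.one_of_one_le ht]
  exact Real.smoothTransition.le_one s

theorem exists_abs_deriv_smoothTransition_le :
    ∃ C : ℝ, 0 ≤ C ∧ ∀ t, |deriv Real.smoothTransition t| ≤ C := by
  have hc : Continuous (deriv Real.smoothTransition) :=
    (Real.smoothTransition.contDiff (n := 1)).continuous_deriv (by simp)
  obtain ⟨C, hC⟩ := (isCompact_Icc (a := (0 : ℝ)) (b := 1)).exists_bound_of_continuousOn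
    hc.continuousOn
  have hC0 : 0 ≤ C := (norm_nonneg _).trans (hC 0 (by simp))
  refine ⟨C, hC0, fun t => ?_⟩
  rcases le_total t 0 with h0 | h0
  · simpa [deriv_smoothTransition_eq_zero_of_nonpos h0] using hC0
  rcases le_total 1 t with h1 | h1
  · simpa [deriv_smoothTransition_eq_zero_of_one_le h1] using hC0
  · exact hC t ⟨h0, h1⟩

theorem hasDerivAt_smoothTransition (t : ℝ) :
    HasDerivAt Real.smoothTransition (deriv Real.smoothTransition t) t :=
  ((Real.smoothTransition.contDiff (n := 1)).differentiable (by simp) t).hasDerivAt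

/-! ### Removal of the cut-off at the lateral boundary. -/

namespace IsStraightening

variable {d : ℕ} {Ω : Set (Space d)} {α K : ℝ} {T S : Space d → Space d}

theorem volume_slab_lt_top (h : IsStraightening Ω α K T S) (a b : ℝ) :
    volume (Ω ∩ axial ⁻¹' Ioo a b) < ⊤ := by
  obtain ⟨C, -, H⟩ := h.exists_volume_slab_le
  refine (measure_mono ?_).trans_lt ((H (max |a| |b|) (by positivity)).trans_lt
    ENNReal.ofReal_lt_top)
  refine inter_subset_inter_right _ (preimage_mono (Ioo_subset_Ioo ?_ ?_))
  · linarith [neg_abs_le a, le_max_left |a| |b|]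
  · exact (le_abs_self b).trans (le_max_right _ _)

theorem integrableOn_of_bounded (h : IsStraightening Ω α K T S) (hΩ : IsOpen Ω)
    {g : Space d → ℝ} (hg : AEStronglyMeasurable g (volume.restrict Ω)) {M : ℝ}
    (hM : ∀ x ∈ Ω, |g x| ≤ M) {L : ℝ} (hL : ∀ x ∈ Ω, L ≤ |axial x| → g x = 0) :
    IntegrableOn g Ω := by
  have hm : MeasurableSet (Ω ∩ axial ⁻¹' Ioo (-L) L) :=
    (hΩ.inter (isOpen_Ioo.preimage continuous_axial)).measurableSet
  have h1 : IntegrableOn g (Ω ∩ axial ⁻¹' Ioo (-L) L) := by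
    refine IntegrableOn.of_bound (h.volume_slab_lt_top _ _)
      (hg.mono_measure (Measure.restrict_mono inter_subset_left le_rfl)) M ?_
    exact (ae_restrict_iff' hm).2 (Eventually.of_forall fun x hx => hM x hx.1)
  refine h1.of_forall_sdiff_eq_zero hΩ.measurableSet fun x hx => hL x hx.1 ?_
  by_contra! hlt
  exact hx.2 ⟨hx.1, abs_lt.1 hlt⟩

theorem isCompact_image_inv (h : IsStraightening Ω α K T S) {a L : ℝ} (ha : a < 1) :
    IsCompact (S '' {y | ‖transverse y‖ ^ 2 ≤ a ∧ |axial y| ≤ L}) ∧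
      S '' {y | ‖transverse y‖ ^ 2 ≤ a ∧ |axial y| ≤ L} ⊆ Ω := by
  have hsub : {y : Space d | ‖transverse y‖ ^ 2 ≤ a ∧ |axial y| ≤ L} ⊆ unitCylinder d := by
    intro y hy
    change ‖transverse y‖ < 1
    nlinarith [norm_nonneg (transverse y), hy.1]
  refine ⟨IsCompact.image_of_continuousOn ?_
    (h.regular_inv.contDiffOn.continuousOn.mono hsub), ?_⟩
  · refine Metric.isCompact_of_isClosed_isBounded ?_ ?_
    · exact (isClosed_le (continuous_transverse.norm.pow 2) continuous_const).inter
        (isClosed_le continuous_axial.abs continuous_const)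
    · refine (Metric.isBounded_closedBall (x := (0 : Space d)) (r := 1 + L)).subset fun y hy => ?_
      rw [mem_closedBall_zero_iff]
      have h1 : ‖transverse y‖ < 1 := hsub hy
      linarith [norm_le_transverse_add_axial y, hy.2]
  · rintro _ ⟨y, hy, rfl⟩
    exact h.mapsTo_inv (hsub hy)

/-- Quantitative cut-off near the boundary. -/
theorem abs_setIntegral_cutoff_le (h : IsStraightening Ω α K T S) (hΩ : IsOpen Ω)
    {F : Space d → Space d} (hF : ContDiffOn ℝ 1 F Ω) (hdiv : ∀ x ∈ Ω, divergence F x = 0)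
    {M : ℝ} (hM : ∀ x ∈ Ω, ‖F x‖ ≤ M) {ζ : Space d → ℝ} (hζ : ContDiffOn ℝ 1 ζ Ω) {A : ℝ}
    (hA : ∀ x ∈ Ω, |ζ x| ≤ A) (hA' : ∀ x ∈ Ω, ‖fderiv ℝ ζ x‖ ≤ A) {L : ℝ}
    (hL : ∀ x ∈ Ω, L ≤ |axial x| → ζ x = 0) {C₀ : ℝ}
    (hC₀ : ∀ t, |deriv Real.smoothTransition t| ≤ C₀) {δ ε : ℝ} (hε : 0 < ε) (hε1 : ε < 1)
    (hlayer : ∀ x ∈ Ω, |axial x| ≤ L → 1 - 3 * ε < ‖transverse (T x)‖ ^ 2 →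
      |inner ℝ (transverse (T x)) (transverse (fderiv ℝ T x (F x)))| ≤ δ) :
    |∫ x in Ω, Real.smoothTransition ((1 - ‖transverse (T x)‖ ^ 2) / ε - 1) *
        fderiv ℝ ζ x (F x)| ≤
      A * (C₀ / ε * (2 * δ)) * volume.real
        (Ω ∩ T ⁻¹' (cylinderSlab d (-L) L ∩ {y | 1 - 3 * ε < ‖transverse y‖ ^ 2})) := by
  set r : Space d → ℝ := fun x => ‖transverse (T x)‖ ^ 2 with hr
  -- This cut-off is 0 where 1 − r ≤ ε and 1 where 1 − r ≥ 2ε. Its derivative therefore lives inside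
  -- the layer 1 − r < 3ε.
  set f : Space d → ℝ := fun x => Real.smoothTransition ((1 - r x) / ε - 1) with hf
  have hT1 : ContDiffOn ℝ 1 T Ω := h.regular.contDiffOn.of_le (by norm_num)
  have hr1 : ContDiffOn ℝ 1 r Ω := ((transverseL d).contDiff.comp_contDiffOn hT1).norm_sq ℝ
  have hf1 : ContDiffOn ℝ 1 f Ω :=
    (Real.smoothTransition.contDiff (n := 1)).comp_contDiffOn
      (((contDiffOn_const.sub hr1).div_const ε).sub contDiffOn_const)
  have hrD : ∀ x ∈ Ω, fderiv ℝ r x (F x) =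
      2 * inner ℝ (transverse (T x)) (transverse (fderiv ℝ T x (F x))) := fun x hx => by
    have := (((transverseL d).hasFDerivAt.comp x (h.differentiableAt hΩ hx).hasFDerivAt).norm_sq)
    have e : fderiv ℝ r x = _ := this.fderiv
    rw [e]
    simp [transverseL_apply]
  have hfD : ∀ x ∈ Ω, fderiv ℝ f x (F x) = -(deriv Real.smoothTransition ((1 - r x) / ε - 1) / ε *
      fderiv ℝ r x (F x)) := fun x hx => by
    have h1 := ((hr1.differentiableOn (by simp)).differentiableAt (hΩ.mem_nhds hx)).hasFDerivAt
    have h2 : HasFDerivAt (fun x => (1 - r x) / ε - 1) (-(ε⁻¹ • fderiv ℝ r x)) x := by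
      have := ((h1.const_sub 1).mul_const ε⁻¹).sub_const 1
      simpa [div_eq_mul_inv] using this
    have h3 := (hasDerivAt_smoothTransition ((1 - r x) / ε - 1)).comp_hasFDerivAt x h2
    have e : fderiv ℝ f x = _ := h3.fderiv
    rw [e]
    simp
    ring
  have hζD : ∀ x ∈ Ω, DifferentiableAt ℝ ζ x := fun x hx =>
    (hζ.differentiableOn (by simp)).differentiableAt (hΩ.mem_nhds hx)
  have hζL : ∀ x ∈ Ω, L + 1 ≤ |axial x| → fderiv ℝ ζ x = 0 := fun x hx hxL => by
    have : ζ =ᶠ[𝓝 x] fun _ => 0 := by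
      filter_upwards [hΩ.mem_nhds hx, continuous_axial.abs.continuousAt.eventually
        (lt_mem_nhds (show L < |axial x| by linarith))] with z hz hzL using hL z hz hzL.le
    rw [this.fderiv_eq]
    simp
  -- The product rule is written as a difference, so that the vanishing of its integral trades the
  -- term with dζ for the one with df, which is supported in the layer.
  have hηD : ∀ x ∈ Ω, fderiv ℝ (fun x => f x * ζ x) x (F x) =
      f x * fderiv ℝ ζ x (F x) - -(ζ x * fderiv ℝ f x (F x)) := fun x hx => by
    rw [fderiv_fun_mul ((hf1.differentiableOn (by simp)).differentiableAt (hΩ.mem_nhds hx))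
      (hζD x hx)]
    simp
  have hfabs : ∀ x, |f x| ≤ 1 := fun x => by
    rw [abs_of_nonneg (Real.smoothTransition.nonneg _)]
    exact Real.smoothTransition.le_one _
  have hzero : ∫ x in Ω, fderiv ℝ (fun x => f x * ζ x) x (F x) = 0 := by
    obtain ⟨hk, hkΩ⟩ := h.isCompact_image_inv (a := 1 - ε) (L := L) (by linarith)
    refine setIntegral_fderiv_apply_eq_zero hΩ hF hdiv (hf1.mul hζ) hk hkΩ fun x hx hxk => ?_
    by_cases hxL : L ≤ |axial x|
    · rw [hL x hx hxL, mul_zero]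
    · have : f x = 0 := by
        refine Real.smoothTransition.zero_of_nonpos ?_
        have : ¬ r x ≤ 1 - ε := fun hrx => hxk ⟨T x, ⟨hrx, by
          rw [h.axial_apply hx]; linarith⟩, h.inv_apply hx⟩
        rw [sub_nonpos, div_le_one hε]
        linarith
      rw [this, zero_mul]
  have hM0 : ∀ x ∈ Ω, 0 ≤ M := fun x hx => (norm_nonneg _).trans (hM x hx)
  have hDr : ∀ x ∈ Ω, |fderiv ℝ r x (F x)| ≤ 2 * (K * M) := fun x hx => by
    rw [hrD x hx, abs_mul, abs_two]
    gcongr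
    refine (abs_real_inner_le_norm _ _).trans ?_
    have h1 : ‖transverse (T x)‖ < 1 := h.mapsTo hx
    calc _ ≤ 1 * ‖fderiv ℝ T x (F x)‖ := by
          gcongr
          exact norm_transverse_le_norm _
      _ ≤ 1 * (K * M) := by
          gcongr
          refine ((fderiv ℝ T x).le_opNorm _).trans ?_
          have := h.nonneg
          gcongr
          exacts [h.regular.bound_one x hx, hM x hx]
      _ = _ := one_mul _
  have hC₀0 : 0 ≤ C₀ := (abs_nonneg _).trans (hC₀ 0)
  have hmeas : ∀ {g : Space d → ℝ}, ContinuousOn g Ω → AEStronglyMeasurable g (volume.restrict Ω) :=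
    fun hg => hg.aestronglyMeasurable hΩ.measurableSet
  have hcD : ∀ {g : Space d → ℝ}, ContDiffOn ℝ 1 g Ω →
      ContinuousOn (fun x => fderiv ℝ g x (F x)) Ω := fun hg =>
    (hg.continuousOn_fderiv_of_isOpen hΩ (by simp)).clm_apply hF.continuousOn
  have hi1 : IntegrableOn (fun x => f x * fderiv ℝ ζ x (F x)) Ω := by
    refine h.integrableOn_of_bounded hΩ (hmeas (hf1.continuousOn.mul (hcD hζ))) (M := 1 * (A * M))
      (fun x hx => ?_) (L := L + 1) fun x hx hxL => by rw [hζL x hx hxL]; simp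
    rw [abs_mul]
    have := hM0 x hx
    have hA0 : 0 ≤ A := (abs_nonneg _).trans (hA x hx)
    gcongr
    · exact hfabs x
    · exact ((fderiv ℝ ζ x).le_opNorm _).trans
        (mul_le_mul (hA' x hx) (hM x hx) (norm_nonneg _) hA0)
  have hi2 : IntegrableOn (fun x => -(ζ x * fderiv ℝ f x (F x))) Ω := by
    refine (h.integrableOn_of_bounded (g := fun x => ζ x * fderiv ℝ f x (F x)) hΩ (hmeas (hζ.continuousOn.mul (hcD hf1)))
      (M := A * (C₀ / ε * (2 * (K * M))))
      (fun x hx => ?_) (L := L) fun x hx hxL => by rw [hL x hx hxL, zero_mul]).neg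
    rw [abs_mul, hfD x hx, abs_neg, abs_mul, abs_div, abs_of_pos hε]
    have hA0 : 0 ≤ A := (abs_nonneg _).trans (hA x hx)
    gcongr
    exacts [hA x hx, hC₀ _, hDr x hx]
  rw [setIntegral_congr_fun hΩ.measurableSet hηD, integral_sub hi1 hi2, sub_eq_zero] at hzero
  have hgoal : ∫ x in Ω, f x * fderiv ℝ ζ x (F x) = ∫ x in Ω, -(ζ x * fderiv ℝ f x (F x)) := hzero
  rw [hgoal]
  set Λ := Ω ∩ T ⁻¹' (cylinderSlab d (-L) L ∩ {y | 1 - 3 * ε < ‖transverse y‖ ^ 2}) with hΛ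
  have hΛs : Λ ⊆ Ω ∩ axial ⁻¹' Ioo (-L) L := fun x hx => by
    refine ⟨hx.1, ?_⟩
    have := hx.2.1.2
    rwa [mem_preimage, h.axial_apply hx.1] at this
  have hvan : ∀ x ∈ Ω \ Λ, -(ζ x * fderiv ℝ f x (F x)) = 0 := by
    rintro x ⟨hx, hxΛ⟩
    by_cases hxL : L ≤ |axial x|
    · rw [hL x hx hxL, zero_mul, neg_zero]
    · have hrx : ¬ 1 - 3 * ε < r x := fun hrx => hxΛ ⟨hx, ⟨h.mapsTo hx, by
        rw [mem_preimage, h.axial_apply hx]; exact abs_lt.1 (not_le.1 hxL)⟩, hrx⟩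
      have h1 : 1 < (1 - r x) / ε - 1 := by
        rw [lt_sub_iff_add_lt, lt_div_iff₀ hε]
        linarith
      rw [hfD x hx, deriv_smoothTransition_eq_zero_of_one_le h1.le]
      simp
  rw [setIntegral_eq_of_subset_of_forall_sdiff_eq_zero hΩ.measurableSet inter_subset_left hvan,
    ← Real.norm_eq_abs]
  refine norm_setIntegral_le_of_norm_le_const
    ((measure_mono hΛs).trans_lt (h.volume_slab_lt_top _ _)) fun x hx => ?_
  have hxΩ := hx.1
  rw [norm_neg, Real.norm_eq_abs, abs_mul, hfD x hxΩ, abs_neg, abs_mul, abs_div, abs_of_pos hε]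
  have hA0 : 0 ≤ A := (abs_nonneg _).trans (hA x hxΩ)
  gcongr
  · exact hA x hxΩ
  · exact hC₀ _
  · rw [hrD x hxΩ, abs_mul, abs_two]
    gcongr
    exact hlayer x hxΩ (abs_le.2 ⟨(hΛs hx).2.1.le, (hΛs hx).2.2.le⟩) hx.2.2

/-- The weak formulation of the Neumann problem for a divergence-free field, with test functions
that need not vanish on the lateral boundary. -/
theorem setIntegral_fderiv_apply_eq_zero (h : IsStraightening Ω α K T S) (hΩ : IsOpen Ω)
    {F : Space d → Space d} (hF : ContDiffOn ℝ 1 F Ω) (hdiv : ∀ x ∈ Ω, divergence F x = 0)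
    {M : ℝ} (hM : ∀ x ∈ Ω, ‖F x‖ ≤ M)
    (hlayer : ∀ L δ : ℝ, 0 < δ → ∃ ε > 0, ∀ x ∈ Ω, |axial x| ≤ L →
      1 - ε < ‖transverse (T x)‖ ^ 2 →
      |inner ℝ (transverse (T x)) (transverse (fderiv ℝ T x (F x)))| ≤ δ)
    {ζ : Space d → ℝ} (hζ : ContDiffOn ℝ 1 ζ Ω) {A : ℝ} (hA0 : 0 ≤ A)
    (hA : ∀ x ∈ Ω, |ζ x| ≤ A) (hA' : ∀ x ∈ Ω, ‖fderiv ℝ ζ x‖ ≤ A) {L : ℝ}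
    (hL : ∀ x ∈ Ω, L ≤ |axial x| → ζ x = 0) :
    IntegrableOn (fun x => fderiv ℝ ζ x (F x)) Ω ∧ ∫ x in Ω, fderiv ℝ ζ x (F x) = 0 := by
  obtain ⟨C₀, hC₀0, hC₀⟩ := exists_abs_deriv_smoothTransition_le
  obtain ⟨C₁, hC₁0, hC₁⟩ := h.exists_volume_layer_le L
  have hcD : ContinuousOn (fun x => fderiv ℝ ζ x (F x)) Ω :=
    (hζ.continuousOn_fderiv_of_isOpen hΩ (by simp)).clm_apply hF.continuousOn
  have hζL : ∀ x ∈ Ω, L + 1 ≤ |axial x| → fderiv ℝ ζ x (F x) = 0 := fun x hx hxL => by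
    have : ζ =ᶠ[𝓝 x] fun _ => 0 := by
      filter_upwards [hΩ.mem_nhds hx, continuous_axial.abs.continuousAt.eventually
        (lt_mem_nhds (show L < |axial x| by linarith))] with z hz hzL using hL z hz hzL.le
    rw [this.fderiv_eq]
    simp
  have hint : IntegrableOn (fun x => fderiv ℝ ζ x (F x)) Ω :=
    h.integrableOn_of_bounded hΩ (hcD.aestronglyMeasurable hΩ.measurableSet) (M := A * M)
      (fun x hx => ((fderiv ℝ ζ x).le_opNorm _).trans
        (mul_le_mul (hA' x hx) (hM x hx) (norm_nonneg _) hA0)) hζL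
  refine ⟨hint, ?_⟩
  set I : ℝ → ℝ := fun ε => ∫ x in Ω,
    Real.smoothTransition ((1 - ‖transverse (T x)‖ ^ 2) / ε - 1) * fderiv ℝ ζ x (F x) with hI
  -- At each point of Ω the cut-off equals 1 once ε is small, so dominated convergence applies.
  have hlim : Tendsto I (𝓝[>] 0) (𝓝 (∫ x in Ω, fderiv ℝ ζ x (F x))) := by
    refine tendsto_integral_filter_of_dominated_convergence (fun x => ‖fderiv ℝ ζ x (F x)‖)
      ?_ ?_ hint.norm ?_
    · refine Eventually.of_forall fun ε => ?_
      refine ContinuousOn.aestronglyMeasurable (ContinuousOn.mul ?_ hcD) hΩ.measurableSet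
      refine Real.smoothTransition.continuous.comp_continuousOn ?_
      exact ((continuousOn_const.sub ((continuous_transverse.comp_continuousOn
        h.regular.contDiffOn.continuousOn).norm.pow 2)).div_const ε).sub continuousOn_const
    · refine Eventually.of_forall fun ε => Eventually.of_forall fun x => ?_
      rw [norm_mul, Real.norm_eq_abs, abs_of_nonneg (Real.smoothTransition.nonneg _)]
      exact mul_le_of_le_one_left (norm_nonneg _) (Real.smoothTransition.le_one _)
    · refine (ae_restrict_iff' hΩ.measurableSet).2 (Eventually.of_forall fun x hx => ?_)
      have h1 : ‖transverse (T x)‖ < 1 := h.mapsTo hx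
      have h2 : 0 < 1 - ‖transverse (T x)‖ ^ 2 := by nlinarith [norm_nonneg (transverse (T x))]
      refine tendsto_const_nhds.congr' ?_
      filter_upwards [Ioo_mem_nhdsGT (half_pos h2)] with ε hε
      rw [Real.smoothTransition.one_of_one_le, one_mul]
      rw [le_sub_iff_add_le, le_div_iff₀ hε.1]
      linarith [hε.2]
  -- The slope C₀/ε of the cut-off cancels against the layer volume C₁·3ε. Only the smallness δ of
  -- the transversal component survives.
  have hbound : ∀ δ > 0, |∫ x in Ω, fderiv ℝ ζ x (F x)| ≤ A * (C₀ * 6 * C₁) * δ := by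
    intro δ hδ
    obtain ⟨ε₀, hε₀, H⟩ := hlayer L δ hδ
    refine le_of_tendsto hlim.abs ?_
    filter_upwards [Ioo_mem_nhdsGT (show 0 < min (1 / 3) (ε₀ / 3) by positivity)] with ε hε
    have hε1 : ε < 1 / 3 := hε.2.trans_le (min_le_left _ _)
    have hε2 : ε < ε₀ / 3 := hε.2.trans_le (min_le_right _ _)
    have hε0 : 0 < ε := hε.1
    refine (h.abs_setIntegral_cutoff_le hΩ hF hdiv hM hζ hA hA' hL hC₀ hε0 (by linarith)
      fun x hx hxL hx1 => H x hx hxL (by linarith)).trans ?_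
    have hv : volume.real (Ω ∩ T ⁻¹' (cylinderSlab d (-L) L ∩
        {y | 1 - 3 * ε < ‖transverse y‖ ^ 2})) ≤ C₁ * (3 * ε) :=
      ENNReal.toReal_le_of_le_ofReal (by positivity) (hC₁ (3 * ε) (by linarith) (by linarith))
    calc _ ≤ A * (C₀ / ε * (2 * δ)) * (C₁ * (3 * ε)) := by gcongr
      _ = _ := by field_simp; ring
  have hc0 : Tendsto (fun δ : ℝ => A * (C₀ * 6 * C₁) * δ) (𝓝[>] 0) (𝓝 0) := by
    have : Tendsto (fun δ : ℝ => A * (C₀ * 6 * C₁) * δ) (𝓝 0) (𝓝 (A * (C₀ * 6 * C₁) * 0)) :=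
      tendsto_id.const_mul _
    rw [mul_zero] at this
    exact this.mono_left nhdsWithin_le_nhds
  have := ge_of_tendsto hc0 (eventually_mem_nhdsWithin.mono fun δ hδ => hbound δ hδ)
  exact abs_eq_zero.1 (le_antisymm this (abs_nonneg _))

end IsStraightening

/-! ### The energy estimate -/

/-- Hole filling: adding C·E(n) to both sides of the step gives E(n) ≤ θE(n+1). After k iterations
θᵏ beats the polynomial bound. -/
theorem eq_zero_of_growth {E : ℕ → ℝ} (hE : ∀ n, 0 ≤ E n) {A : ℝ} {m : ℕ}
    (hA : ∀ n : ℕ, E n ≤ A * (n + 1 : ℕ) ^ m) {l C : ℝ} (hl : 0 < l) (hC : 0 < C)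
    (hstep : ∀ n, l * E n ≤ C * (E (n + 1) - E n)) (n : ℕ) : E n = 0 := by
  set θ := C / (C + l) with hθ
  have hθ0 : 0 < θ := by positivity
  have hθ1 : θ < 1 := by rw [hθ, div_lt_one (by positivity)]; linarith
  have h1 : ∀ n, E n ≤ θ * E (n + 1) := fun n => by
    rw [hθ, div_mul_eq_mul_div, le_div_iff₀ (by positivity)]
    linarith [hstep n]
  have h2 : ∀ k, E n ≤ θ ^ k * E (n + k) := by
    intro k
    induction k with
    | zero => simp
    | succ k ih =>
      refine ih.trans ?_
      rw [pow_succ, mul_assoc]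
      gcongr
      exact h1 (n + k)
  -- The extra factor θ^(n+1) aligns the exponent with the base k + n + 1, leaving a shifted
  -- sequence jᵐθʲ.
  have h3 : ∀ k, E n * θ ^ (n + 1) ≤ A * ((k + (n + 1) : ℕ) ^ m * θ ^ (k + (n + 1))) := by
    intro k
    calc _ ≤ (θ ^ k * E (n + k)) * θ ^ (n + 1) := by gcongr; exact h2 k
      _ ≤ (θ ^ k * (A * (n + k + 1 : ℕ) ^ m)) * θ ^ (n + 1) := by gcongr; exact hA (n + k)
      _ = _ := by
        rw [show n + k + 1 = k + (n + 1) by ring, pow_add θ k]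
        ring
  have h4 : Tendsto (fun k : ℕ => A * (((k + (n + 1) : ℕ) : ℝ) ^ m * θ ^ (k + (n + 1)))) atTop
      (𝓝 (A * 0)) :=
    ((tendsto_pow_const_mul_const_pow_of_abs_lt_one m
      (by rw [abs_of_pos hθ0]; exact hθ1)).comp (tendsto_add_atTop_nat (n + 1))).const_mul A
  have h5 : E n * θ ^ (n + 1) ≤ A * 0 := ge_of_tendsto' h4 h3
  rw [mul_zero] at h5
  have := hE n
  have hp : 0 < θ ^ (n + 1) := by positivity
  nlinarith

/-- A smooth cut-off which is `1` on `[-a, a]` and vanishes outside `(-a - 1, a + 1)`. -/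
noncomputable def bump (a t : ℝ) : ℝ :=
  Real.smoothTransition (a + 1 - t) * Real.smoothTransition (a + 1 + t)

theorem contDiff_bump (a : ℝ) : ContDiff ℝ 1 (bump a) :=
  ((Real.smoothTransition.contDiff (n := 1)).comp (contDiff_const.sub contDiff_id)).mul
    ((Real.smoothTransition.contDiff (n := 1)).comp (contDiff_const.add contDiff_id))

theorem bump_nonneg (a t : ℝ) : 0 ≤ bump a t :=
  mul_nonneg (Real.smoothTransition.nonneg _) (Real.smoothTransition.nonneg _)

theorem bump_le_one (a t : ℝ) : bump a t ≤ 1 :=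
  mul_le_one₀ (Real.smoothTransition.le_one _) (Real.smoothTransition.nonneg _)
    (Real.smoothTransition.le_one _)

theorem bump_eq_one {a t : ℝ} (h : |t| ≤ a) : bump a t = 1 := by
  have := abs_le.1 h
  rw [bump, Real.smoothTransition.one_of_one_le (by linarith),
    Real.smoothTransition.one_of_one_le (by linarith), one_mul]

theorem bump_eq_zero {a t : ℝ} (h : a + 1 ≤ |t|) : bump a t = 0 := by
  rcases le_abs'.1 h with h | h
  · rw [bump, Real.smoothTransition.zero_of_nonpos (x := a + 1 + t) (by linarith), mul_zero]
  · rw [bump, Real.smoothTransition.zero_of_nonpos (x := a + 1 - t) (by linarith), zero_mul]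

theorem deriv_bump_eq_zero {a t : ℝ} (h : |t| ≤ a ∨ a + 1 ≤ |t|) : deriv (bump a) t = 0 := by
  rcases h with h | h
  · refine IsLocalMax.deriv_eq_zero (Eventually.of_forall fun s => ?_)
    rw [bump_eq_one h]
    exact bump_le_one a s
  · refine IsLocalMin.deriv_eq_zero (Eventually.of_forall fun s => ?_)
    rw [bump_eq_zero h]
    exact bump_nonneg a s

theorem exists_abs_deriv_bump_le : ∃ C : ℝ, 0 < C ∧ ∀ a t, |deriv (bump a) t| ≤ C := by
  obtain ⟨C, hC0, hC⟩ := exists_abs_deriv_smoothTransition_le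
  refine ⟨2 * C + 1, by positivity, fun a t => ?_⟩
  have h1 := (hasDerivAt_smoothTransition (a + 1 - t)).comp t ((hasDerivAt_id t).const_sub (a + 1))
  have h2 := (hasDerivAt_smoothTransition (a + 1 + t)).comp t ((hasDerivAt_id t).const_add (a + 1))
  have h3 : deriv (bump a) t = _ := (h1.mul h2).deriv
  rw [h3]
  refine (abs_add_le _ _).trans ?_
  rw [abs_mul, abs_mul, abs_mul, abs_mul]
  simp only [Function.comp_apply, abs_neg, abs_one, mul_one]
  rw [abs_of_nonneg (Real.smoothTransition.nonneg _), abs_of_nonneg (Real.smoothTransition.nonneg _)]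
  have := mul_le_mul (hC (a + 1 - t)) (Real.smoothTransition.le_one (a + 1 + t))
    (Real.smoothTransition.nonneg _) hC0
  have := mul_le_mul (Real.smoothTransition.le_one (a + 1 - t)) (hC (a + 1 + t))
    (abs_nonneg _) zero_le_one
  linarith

/-! ### Bounds on slabs and the flux estimate. -/

namespace IsStraightening

variable {d : ℕ} {Ω : Set (Space d)} {α K : ℝ} {T S : Space d → Space d}

/-- The potential may be unbounded on the whole nozzle. On the convex cylinder ψ ∘ S is Lipschitz,
which bounds it on finite portions and makes the truncated potential admissible as a test function.
-/
theorem exists_abs_le_of_norm_fderiv_le (h : IsStraightening Ω α K T S) (hΩ : IsOpen Ω)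
    {ψ : Space d → ℝ} (hψ : ContDiffOn ℝ 1 ψ Ω) {P : ℝ} (hP : ∀ x ∈ Ω, ‖fderiv ℝ ψ x‖ ≤ P)
    (L : ℝ) : ∃ A, 0 ≤ A ∧ ∀ x ∈ Ω, |axial x| ≤ L → |ψ x| ≤ A := by
  obtain ⟨y₀, hy₀⟩ := unitCylinder_nonempty d
  have hK := h.nonneg
  have hP0 : 0 ≤ P := (norm_nonneg _).trans (hP (S y₀) (h.mapsTo_inv hy₀))
  refine ⟨|ψ (S y₀)| + P * K * (1 + |L| + ‖y₀‖), by positivity, fun x hx hxL => ?_⟩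
  have hlip := (convex_unitCylinder d).norm_image_sub_le_of_norm_hasFDerivWithin_le
    (f := fun y => ψ (S y)) (f' := fun y => (fderiv ℝ ψ (S y)).comp (fderiv ℝ S y)) (C := P * K)
    (fun y hy => (((hψ.differentiableOn (by simp)).differentiableAt
      (hΩ.mem_nhds (h.mapsTo_inv hy))).hasFDerivAt.comp y
        (h.differentiableAt_inv hy).hasFDerivAt).hasFDerivWithinAt)
    (fun y hy => (ContinuousLinearMap.opNorm_comp_le _ _).trans (mul_le_mul
      (hP _ (h.mapsTo_inv hy)) (h.regular_inv.bound_one y hy) (norm_nonneg _) hP0))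
    hy₀ (h.mapsTo hx)
  rw [h.inv_apply hx, Real.norm_eq_abs] at hlip
  have h1 : ‖transverse (T x)‖ < 1 := h.mapsTo hx
  have h2 : ‖T x - y₀‖ ≤ 1 + |L| + ‖y₀‖ := by
    refine (norm_sub_le _ _).trans ?_
    have := norm_le_transverse_add_axial (T x)
    rw [h.axial_apply hx] at this
    linarith [le_abs_self L]
  have h3 : P * K * ‖T x - y₀‖ ≤ P * K * (1 + |L| + ‖y₀‖) := by gcongr
  have h4 := abs_sub_abs_le_abs_sub (ψ x) (ψ (S y₀))
  linarith

theorem integrableOn_slab (h : IsStraightening Ω α K T S) (hΩ : IsOpen Ω)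
    {g : Space d → ℝ} (hg : AEStronglyMeasurable g (volume.restrict Ω)) {a b M : ℝ}
    (hM : ∀ x ∈ Ω ∩ axial ⁻¹' Ioo a b, |g x| ≤ M) :
    IntegrableOn g (Ω ∩ axial ⁻¹' Ioo a b) := by
  have hm : MeasurableSet (Ω ∩ axial ⁻¹' Ioo a b) :=
    (hΩ.inter (isOpen_Ioo.preimage continuous_axial)).measurableSet
  refine IntegrableOn.of_bound (h.volume_slab_lt_top _ _)
    (hg.mono_measure (Measure.restrict_mono inter_subset_left le_rfl)) M ?_
  exact (ae_restrict_iff' hm).2 (Eventually.of_forall hM)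

theorem integrableOn_norm_fderiv_sq (h : IsStraightening Ω α K T S) (hΩ : IsOpen Ω)
    {ψ : Space d → ℝ} (hψ : ContDiffOn ℝ 1 ψ Ω) {P : ℝ} (hP : ∀ x ∈ Ω, ‖fderiv ℝ ψ x‖ ≤ P)
    (a b : ℝ) : IntegrableOn (fun x => ‖fderiv ℝ ψ x‖ ^ 2) (Ω ∩ axial ⁻¹' Ioo a b) := by
  refine h.integrableOn_slab (g := fun x => ‖fderiv ℝ ψ x‖ ^ 2) hΩ
    (ContinuousOn.aestronglyMeasurable
      ((hψ.continuousOn_fderiv_of_isOpen hΩ (by simp)).norm.pow 2) hΩ.measurableSet)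
    (M := P ^ 2) fun x hx => ?_
  rw [abs_of_nonneg (by positivity)]
  gcongr
  exact hP x hx.1

/-- Poincaré's inequality on slabs, for Bochner integrals. -/
theorem exists_integral_poincare (h : IsStraightening Ω α K T S) (hΩ : IsOpen Ω) :
    ∃ C : ℝ, 0 ≤ C ∧ ∀ ψ : Space d → ℝ, ContDiffOn ℝ 1 ψ Ω → ∀ P : ℝ,
      (∀ x ∈ Ω, ‖fderiv ℝ ψ x‖ ≤ P) → ∀ a : ℝ, ∃ c : ℝ,
      ∫ x in Ω ∩ axial ⁻¹' Ioo a (a + 1), (ψ x - c) ^ 2 ≤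
        C * ∫ x in Ω ∩ axial ⁻¹' Ioo a (a + 1), ‖fderiv ℝ ψ x‖ ^ 2 := by
  obtain ⟨C, hC, H⟩ := h.exists_poincare hΩ
  refine ⟨C.toReal, ENNReal.toReal_nonneg, fun ψ hψ P hP a => ?_⟩
  obtain ⟨c, hc⟩ := H ψ hψ a
  refine ⟨c, ?_⟩
  have hi : IntegrableOn (fun x => ‖fderiv ℝ ψ x‖ ^ 2) (Ω ∩ axial ⁻¹' Ioo a (a + 1)) :=
    h.integrableOn_norm_fderiv_sq hΩ hψ hP _ _
  have e1 : ENNReal.ofReal (∫ x in Ω ∩ axial ⁻¹' Ioo a (a + 1), ‖fderiv ℝ ψ x‖ ^ 2) =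
      ∫⁻ x in Ω ∩ axial ⁻¹' Ioo a (a + 1), ‖fderiv ℝ ψ x‖ₑ ^ 2 := by
    rw [ofReal_integral_eq_lintegral_ofReal hi (Eventually.of_forall fun _ => by positivity)]
    simp_rw [ENNReal.ofReal_pow (norm_nonneg _), ofReal_norm]
  rw [integral_eq_lintegral_of_nonneg_ae (f := fun x => (ψ x - c) ^ 2) (Eventually.of_forall fun _ => sq_nonneg _)
    ((((hψ.continuousOn.mono inter_subset_left).sub continuousOn_const).pow 2).aestronglyMeasurable
      (hΩ.inter (isOpen_Ioo.preimage continuous_axial)).measurableSet)]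
  refine ENNReal.toReal_le_of_le_ofReal
    (mul_nonneg ENNReal.toReal_nonneg (integral_nonneg fun _ => by positivity)) ?_
  rw [ENNReal.ofReal_mul ENNReal.toReal_nonneg, ENNReal.ofReal_toReal hC, e1]
  simpa only [enorm_sq_eq_ofReal] using hc

/-- The flux through a slab is controlled by the energy in the slab, because the potential may be
normalized there. -/
theorem abs_setIntegral_slab_le (h : IsStraightening Ω α K T S) (hΩ : IsOpen Ω)
    {ψ : Space d → ℝ} (hψ : ContDiffOn ℝ 1 ψ Ω) {P : ℝ} (hP : ∀ x ∈ Ω, ‖fderiv ℝ ψ x‖ ≤ P)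
    {G : Space d → Space d} (hG : ContinuousOn G Ω) {Λ : ℝ} (hΛ : 0 ≤ Λ)
    (hGΛ : ∀ x ∈ Ω, ‖G x‖ ≤ Λ * ‖fderiv ℝ ψ x‖) {a c C : ℝ}
    (hc : ∫ x in Ω ∩ axial ⁻¹' Ioo a (a + 1), (ψ x - c) ^ 2 ≤
        C * ∫ x in Ω ∩ axial ⁻¹' Ioo a (a + 1), ‖fderiv ℝ ψ x‖ ^ 2)
    {w : ℝ → ℝ} (hw : Measurable w) {W : ℝ} (hW : ∀ t, |w t| ≤ W)
    (hflux : ∫ x in Ω ∩ axial ⁻¹' Ioo a (a + 1), w (axial x) * axial (G x) = 0) :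
    |∫ x in Ω ∩ axial ⁻¹' Ioo a (a + 1), w (axial x) * ψ x * axial (G x)| ≤
      W * (C + Λ ^ 2) * ∫ x in Ω ∩ axial ⁻¹' Ioo a (a + 1), ‖fderiv ℝ ψ x‖ ^ 2 := by
  set D := Ω ∩ axial ⁻¹' Ioo a (a + 1) with hD
  have hDm : MeasurableSet D := (hΩ.inter (isOpen_Ioo.preimage continuous_axial)).measurableSet
  obtain ⟨A, hA0, hA⟩ := h.exists_abs_le_of_norm_fderiv_le hΩ hψ hP (|a| + 1)
  have hAD : ∀ x ∈ D, |ψ x| ≤ A := fun x hx => by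
    refine hA x hx.1 (abs_le.2 ⟨?_, ?_⟩)
    · linarith [hx.2.1, neg_abs_le a]
    · linarith [hx.2.2, le_abs_self a]
  have hW0 : 0 ≤ W := (abs_nonneg _).trans (hW 0)
  have hGP : ∀ x ∈ D, |axial (G x)| ≤ Λ * P := fun x hx =>
    (abs_axial_le_norm _).trans ((hGΛ x hx.1).trans (by gcongr; exact hP x hx.1))
  have hwm : AEStronglyMeasurable (fun x : Space d => w (axial x)) (volume.restrict Ω) :=
    (hw.comp continuous_axial.measurable).aestronglyMeasurable
  have hGm : AEStronglyMeasurable (fun x => axial (G x)) (volume.restrict Ω) :=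
    (continuous_axial.comp_continuousOn hG).aestronglyMeasurable hΩ.measurableSet
  have hψm : AEStronglyMeasurable ψ (volume.restrict Ω) :=
    hψ.continuousOn.aestronglyMeasurable hΩ.measurableSet
  have i1 : IntegrableOn (fun x => w (axial x) * ψ x * axial (G x)) D := by
    refine h.integrableOn_slab (g := fun x => w (axial x) * ψ x * axial (G x)) hΩ ((hwm.mul hψm).mul hGm) (M := W * A * (Λ * P)) fun x hx => ?_
    rw [abs_mul, abs_mul]
    gcongr
    exacts [hW _, hAD x hx, hGP x hx]
  have i2 : IntegrableOn (fun x => c * (w (axial x) * axial (G x))) D := by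
    refine Integrable.const_mul ?_ c
    refine h.integrableOn_slab (g := fun x => w (axial x) * axial (G x)) hΩ (hwm.mul hGm) (M := W * (Λ * P)) fun x hx => ?_
    rw [abs_mul]
    gcongr
    exacts [hW _, hGP x hx]
  have i3 : IntegrableOn (fun x => (ψ x - c) ^ 2) D := by
    refine h.integrableOn_slab (g := fun x => (ψ x - c) ^ 2) hΩ ((hψm.sub aestronglyMeasurable_const).pow 2)
      (M := (A + |c|) ^ 2) fun x hx => ?_
    rw [abs_of_nonneg (by positivity)]
    rw [← sq_abs]
    gcongr
    exact (abs_sub _ _).trans (by gcongr; exact hAD x hx)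
  have i4 : IntegrableOn (fun x => ‖fderiv ℝ ψ x‖ ^ 2) D :=
    h.integrableOn_norm_fderiv_sq hΩ hψ hP _ _
  -- The zero flux is used here: subtracting c from ψ does not change the integral.
  have e : ∫ x in D, w (axial x) * ψ x * axial (G x) =
      ∫ x in D, (w (axial x) * ψ x * axial (G x) - c * (w (axial x) * axial (G x))) := by
    rw [integral_sub i1 i2, integral_const_mul, hflux, mul_zero, sub_zero]
  rw [e, ← Real.norm_eq_abs]
  calc _ ≤ ∫ x in D, (W * (ψ x - c) ^ 2 + W * Λ ^ 2 * ‖fderiv ℝ ψ x‖ ^ 2) := by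
        refine norm_integral_le_of_norm_le ((i3.const_mul W).add (i4.const_mul (W * Λ ^ 2)))
          ((ae_restrict_iff' hDm).2 (Eventually.of_forall fun x hx => ?_))
        have e2 : w (axial x) * ψ x * axial (G x) - c * (w (axial x) * axial (G x)) =
            w (axial x) * ((ψ x - c) * axial (G x)) := by ring
        rw [e2, Real.norm_eq_abs, abs_mul, abs_mul, ← sq_abs (ψ x - c)]
        have h1 : |axial (G x)| ≤ Λ * ‖fderiv ℝ ψ x‖ := (abs_axial_le_norm _).trans (hGΛ x hx.1)
        have h2 : |ψ x - c| * |axial (G x)| ≤ |ψ x - c| ^ 2 + Λ ^ 2 * ‖fderiv ℝ ψ x‖ ^ 2 := by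
          have h3 : |ψ x - c| * |axial (G x)| ≤ |ψ x - c| * (Λ * ‖fderiv ℝ ψ x‖) := by gcongr
          nlinarith [sq_nonneg (|ψ x - c| - Λ * ‖fderiv ℝ ψ x‖),
            sq_nonneg (|ψ x - c|), sq_nonneg (Λ * ‖fderiv ℝ ψ x‖)]
        calc _ ≤ W * (|ψ x - c| ^ 2 + Λ ^ 2 * ‖fderiv ℝ ψ x‖ ^ 2) := by
              gcongr
              exact hW _
          _ = _ := by ring
    _ = W * (∫ x in D, (ψ x - c) ^ 2) + W * Λ ^ 2 * ∫ x in D, ‖fderiv ℝ ψ x‖ ^ 2 := by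
        rw [integral_add (i3.const_mul W) (i4.const_mul (W * Λ ^ 2)), integral_const_mul,
          integral_const_mul]
    _ ≤ W * (C * ∫ x in D, ‖fderiv ℝ ψ x‖ ^ 2) + W * Λ ^ 2 * ∫ x in D, ‖fderiv ℝ ψ x‖ ^ 2 := by
        gcongr
    _ = _ := by ring

end IsStraightening

/-! ### Growth and vanishing of the energy. -/

namespace IsStraightening

variable {d : ℕ} {Ω : Set (Space d)} {α K : ℝ} {T S : Space d → Space d}

/-- The energy of a potential between the cross sections at `-a` and `a`. -/
noncomputable def energy (Ω : Set (Space d)) (ψ : Space d → ℝ) (a : ℝ) : ℝ :=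
  ∫ x in Ω ∩ axial ⁻¹' Ioo (-a) a, ‖fderiv ℝ ψ x‖ ^ 2

theorem energy_nonneg (Ω : Set (Space d)) (ψ : Space d → ℝ) (a : ℝ) : 0 ≤ energy Ω ψ a :=
  integral_nonneg fun _ => by positivity

/-- Three disjoint open slabs lie in the larger one; the sections at ±a are left out, and an
inequality suffices. The interval (−a−1, −a−1+1) is kept in the form (b, b+1) of the slab estimates.
-/
theorem energy_add_le (h : IsStraightening Ω α K T S) (hΩ : IsOpen Ω) {ψ : Space d → ℝ}
    (hψ : ContDiffOn ℝ 1 ψ Ω) {P : ℝ} (hP : ∀ x ∈ Ω, ‖fderiv ℝ ψ x‖ ≤ P) {a : ℝ} (ha : 0 ≤ a) :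
    energy Ω ψ a + ((∫ x in Ω ∩ axial ⁻¹' Ioo a (a + 1), ‖fderiv ℝ ψ x‖ ^ 2) +
      ∫ x in Ω ∩ axial ⁻¹' Ioo (-a - 1) (-a - 1 + 1), ‖fderiv ℝ ψ x‖ ^ 2) ≤
      energy Ω ψ (a + 1) := by
  have hm : ∀ s t, MeasurableSet (Ω ∩ axial ⁻¹' Ioo s t) := fun s t =>
    (hΩ.inter (isOpen_Ioo.preimage continuous_axial)).measurableSet
  have hi := fun s t => h.integrableOn_norm_fderiv_sq hΩ hψ hP s t
  have hd1 : Disjoint (Ω ∩ axial ⁻¹' Ioo a (a + 1))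
      (Ω ∩ axial ⁻¹' Ioo (-a - 1) (-a - 1 + 1)) :=
    Set.disjoint_left.2 fun x hx hx' => by linarith [hx.2.1, hx'.2.2]
  have hd2 : Disjoint (Ω ∩ axial ⁻¹' Ioo (-a) a) (Ω ∩ axial ⁻¹' Ioo a (a + 1) ∪
      Ω ∩ axial ⁻¹' Ioo (-a - 1) (-a - 1 + 1)) :=
    Set.disjoint_left.2 fun x hx hx' => by
      rcases hx' with hx' | hx'
      · linarith [hx.2.2, hx'.2.1]
      · linarith [hx.2.1, hx'.2.2]
  rw [energy, energy, ← setIntegral_union hd1 (hm _ _) (hi _ _) (hi _ _),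
    ← setIntegral_union hd2 ((hm _ _).union (hm _ _)) (hi _ _) ((hi _ _).union (hi _ _))]
  refine setIntegral_mono_set (hi _ _) (Eventually.of_forall fun _ => by positivity)
    (LE.le.eventuallyLE ?_)
  rintro x (hx | hx | hx) <;> refine ⟨hx.1, ?_, ?_⟩ <;> linarith [hx.2.1, hx.2.2]

/-- Testing with `bump a` times ψ leaves, besides the weighted energy, only the term where the bump
is differentiated, carried by the two end slabs. The flux estimate applies to each slab with its own
constant, and C is chosen before a. -/
theorem exists_energy_step (h : IsStraightening Ω α K T S) (hΩ : IsOpen Ω)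
    {ψ : Space d → ℝ} (hψ : ContDiffOn ℝ 1 ψ Ω) {P : ℝ} (hP : ∀ x ∈ Ω, ‖fderiv ℝ ψ x‖ ≤ P)
    {G : Space d → Space d} (hG : ContinuousOn G Ω) {l Λ : ℝ} (hl : 0 < l) (hΛ : 0 ≤ Λ)
    (hGΛ : ∀ x ∈ Ω, ‖G x‖ ≤ Λ * ‖fderiv ℝ ψ x‖)
    (hell : ∀ x ∈ Ω, l * ‖fderiv ℝ ψ x‖ ^ 2 ≤ fderiv ℝ ψ x (G x))
    (hweak : ∀ ζ : Space d → ℝ, ContDiffOn ℝ 1 ζ Ω → ∀ A, 0 ≤ A → (∀ x ∈ Ω, |ζ x| ≤ A) →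
      (∀ x ∈ Ω, ‖fderiv ℝ ζ x‖ ≤ A) → ∀ L, (∀ x ∈ Ω, L ≤ |axial x| → ζ x = 0) →
      ∫ x in Ω, fderiv ℝ ζ x (G x) = 0)
    (hflux : ∀ w : ℝ → ℝ, Measurable w → ∀ W, (∀ t, |w t| ≤ W) → ∀ L,
      (∀ t, L ≤ |t| → w t = 0) → ∫ x in Ω, w (axial x) * axial (G x) = 0) :
    ∃ C > 0, ∀ a, 0 ≤ a → l * energy Ω ψ a ≤ C * (energy Ω ψ (a + 1) - energy Ω ψ a) := by
  obtain ⟨W, hW0, hW⟩ := exists_abs_deriv_bump_le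
  obtain ⟨C, hC0, hC⟩ := h.exists_integral_poincare hΩ
  -- The added 1 only secures positivity, since C and Λ may both be 0.
  refine ⟨W * (C + Λ ^ 2) + 1, by positivity, fun a ha => ?_⟩
  have hm : ∀ s t, MeasurableSet (Ω ∩ axial ⁻¹' Ioo s t) := fun s t =>
    (hΩ.inter (isOpen_Ioo.preimage continuous_axial)).measurableSet
  set w := deriv (bump a) with hw
  have hwc : Continuous w := (contDiff_bump a).continuous_deriv (by simp)
  obtain ⟨A, hA0, hA⟩ := h.exists_abs_le_of_norm_fderiv_le hΩ hψ hP (a + 1)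
  have hP0 : ∀ x ∈ Ω, 0 ≤ P := fun x hx => (norm_nonneg _).trans (hP x hx)
  -- the flux through each of the two slabs
  have hslab : ∀ b : ℝ, |∫ x in Ω ∩ axial ⁻¹' Ioo b (b + 1), w (axial x) * ψ x * axial (G x)| ≤
      W * (C + Λ ^ 2) * ∫ x in Ω ∩ axial ⁻¹' Ioo b (b + 1), ‖fderiv ℝ ψ x‖ ^ 2 := by
    intro b
    obtain ⟨c, hc⟩ := hC ψ hψ P hP b
    refine h.abs_setIntegral_slab_le hΩ hψ hP hG hΛ hGΛ hc hwc.measurable (hW a) ?_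
    -- Flux weights need only be bounded and measurable, so the weight can be cut sharply to one
    -- slab.
    have h1 := hflux ((Ioo b (b + 1)).indicator w) (hwc.measurable.indicator measurableSet_Ioo) W
      (fun t => by
        by_cases ht : t ∈ Ioo b (b + 1)
        · rw [indicator_of_mem ht]; exact hW a t
        · rw [indicator_of_notMem ht, abs_zero]; exact hW0.le) (|b| + 1) (fun t ht => by
        refine indicator_of_notMem (fun hb => ?_) _
        rcases le_abs'.1 ht with h2 | h2
        · linarith [hb.1, neg_abs_le b]
        · linarith [hb.2, le_abs_self b])
    rw [setIntegral_eq_of_subset_of_forall_sdiff_eq_zero hΩ.measurableSet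
      (inter_subset_left (t := axial ⁻¹' Ioo b (b + 1)))] at h1
    · rw [← h1]
      refine setIntegral_congr_fun (hm _ _) fun x hx => ?_
      simp only [indicator_of_mem (show axial x ∈ Ioo b (b + 1) from hx.2)]
    · rintro x ⟨hx, hxb⟩
      rw [indicator_of_notMem (show axial x ∉ Ioo b (b + 1) from fun hb => hxb ⟨hx, hb⟩), zero_mul]
  -- testing the equation with the truncated potential
  set ζ : Space d → ℝ := fun x => bump a (axial x) * ψ x with hζ
  have hχ : ContDiff ℝ 1 fun x : Space d => bump a (axial x) :=
    (contDiff_bump a).comp (axialL d).contDiff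
  have hχD : ∀ x : Space d, HasFDerivAt (fun x : Space d => bump a (axial x))
      (w (axial x) • axialL d) x := fun x =>
    (((contDiff_bump a).differentiable (by simp) _).hasDerivAt).comp_hasFDerivAt x
      (axialL d).hasFDerivAt
  have hζ1 : ContDiffOn ℝ 1 ζ Ω := hχ.contDiffOn.mul hψ
  have hζD : ∀ x ∈ Ω, fderiv ℝ ζ x =
      bump a (axial x) • fderiv ℝ ψ x + ψ x • w (axial x) • axialL d := fun x hx =>
    ((hχD x).mul ((hψ.differentiableOn (by simp)).differentiableAt
      (hΩ.mem_nhds hx)).hasFDerivAt).fderiv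
  have hψw : ∀ x ∈ Ω, |ψ x * w (axial x)| ≤ A * W := fun x hx => by
    by_cases hxa : |axial x| ≤ a + 1
    · rw [abs_mul]
      gcongr
      exacts [hA x hx hxa, hW a _]
    · rw [hw, deriv_bump_eq_zero (Or.inr (not_le.1 hxa).le), mul_zero, abs_zero]
      positivity
  have haxialL : ‖axialL d‖ ≤ 1 := ContinuousLinearMap.opNorm_le_bound _ zero_le_one fun x => by
    rw [one_mul]; exact abs_axial_le_norm x
  have hb1 : ∀ t, |bump a t| ≤ 1 := fun t => by
    rw [abs_of_nonneg (bump_nonneg a t)]; exact bump_le_one a t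
  have htest : ∫ x in Ω, fderiv ℝ ζ x (G x) = 0 := by
    refine hweak ζ hζ1 (max A (|P| + A * W)) (by positivity) (fun x hx => ?_) (fun x hx => ?_)
      (a + 1) fun x hx hxa => by rw [hζ]; simp only [bump_eq_zero hxa, zero_mul]
    · refine le_max_of_le_left ?_
      by_cases hxa : |axial x| ≤ a + 1
      · rw [hζ, abs_mul, ← one_mul A]
        gcongr
        exacts [hb1 _, hA x hx hxa]
      · simp only [hζ, bump_eq_zero (not_le.1 hxa).le, zero_mul, abs_zero]
        exact hA0
    · refine le_max_of_le_right ?_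
      rw [hζD x hx, smul_smul]
      refine (norm_add_le _ _).trans ?_
      rw [norm_smul, norm_smul, Real.norm_eq_abs, Real.norm_eq_abs]
      refine add_le_add ?_ ?_
      · rw [← one_mul |P|]
        gcongr
        exacts [hb1 _, (hP x hx).trans (le_abs_self P)]
      · rw [← mul_one (A * W)]
        gcongr
        exact hψw x hx
  have hcψ : ContinuousOn (fun x => fderiv ℝ ψ x (G x)) Ω :=
    (hψ.continuousOn_fderiv_of_isOpen hΩ (by simp)).clm_apply hG
  have hGP : ∀ x ∈ Ω, ‖G x‖ ≤ Λ * P := fun x hx =>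
    (hGΛ x hx).trans (by gcongr; exact hP x hx)
  have hDG : ∀ x ∈ Ω, |fderiv ℝ ψ x (G x)| ≤ P * (Λ * P) := fun x hx =>
    ((fderiv ℝ ψ x).le_opNorm _).trans
      (mul_le_mul (hP x hx) (hGP x hx) (norm_nonneg _) (hP0 x hx))
  have i1 : IntegrableOn (fun x => bump a (axial x) * fderiv ℝ ψ x (G x)) Ω := by
    refine h.integrableOn_of_bounded (g := fun x => bump a (axial x) * fderiv ℝ ψ x (G x)) hΩ
      ((hχ.continuous.continuousOn.mul hcψ).aestronglyMeasurable hΩ.measurableSet)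
      (M := 1 * (P * (Λ * P))) (fun x hx => ?_) (L := a + 1) fun x hx hxa => by
        rw [bump_eq_zero hxa, zero_mul]
    rw [abs_mul]
    gcongr
    exacts [hb1 _, hDG x hx]
  have i2 : IntegrableOn (fun x => w (axial x) * ψ x * axial (G x)) Ω := by
    refine h.integrableOn_of_bounded (g := fun x => w (axial x) * ψ x * axial (G x)) hΩ
      ((((hwc.comp continuous_axial).continuousOn.mul hψ.continuousOn).mul
        (continuous_axial.comp_continuousOn hG)).aestronglyMeasurable hΩ.measurableSet)
      (M := A * W * (Λ * P)) (fun x hx => ?_) (L := a + 1) fun x hx hxa => by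
        rw [hw, deriv_bump_eq_zero (Or.inr hxa), zero_mul, zero_mul]
    rw [abs_mul, mul_comm (w _)]
    gcongr
    exacts [hψw x hx, (abs_axial_le_norm _).trans (hGP x hx)]
  have hsplit : (∫ x in Ω, bump a (axial x) * fderiv ℝ ψ x (G x)) +
      ∫ x in Ω, w (axial x) * ψ x * axial (G x) = 0 := by
    rw [← integral_add i1 i2, ← htest]
    refine setIntegral_congr_fun hΩ.measurableSet fun x hx => ?_
    simp only [hζD x hx, _root_.add_apply, _root_.smul_apply,
      smul_eq_mul, axialL_apply]
    ring
  have hlower : l * energy Ω ψ a ≤ ∫ x in Ω, bump a (axial x) * fderiv ℝ ψ x (G x) := by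
    rw [energy, ← integral_const_mul]
    have hnn : ∀ x ∈ Ω, 0 ≤ fderiv ℝ ψ x (G x) := fun x hx =>
      le_trans (by positivity) (hell x hx)
    calc _ ≤ ∫ x in Ω ∩ axial ⁻¹' Ioo (-a) a, bump a (axial x) * fderiv ℝ ψ x (G x) := by
          refine setIntegral_mono_on ((h.integrableOn_norm_fderiv_sq hΩ hψ hP _ _).const_mul l)
            (i1.mono_set inter_subset_left) (hm _ _) fun x hx => ?_
          rw [bump_eq_one (abs_le.2 ⟨hx.2.1.le, hx.2.2.le⟩), one_mul]
          exact hell x hx.1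
      _ ≤ _ := by
          refine setIntegral_mono_set i1 ((ae_restrict_iff' hΩ.measurableSet).2
            (Eventually.of_forall fun x hx => mul_nonneg (bump_nonneg _ _) (hnn x hx)))
            (LE.le.eventuallyLE inter_subset_left)
  have hupper : |∫ x in Ω, w (axial x) * ψ x * axial (G x)| ≤ W * (C + Λ ^ 2) *
      ((∫ x in Ω ∩ axial ⁻¹' Ioo a (a + 1), ‖fderiv ℝ ψ x‖ ^ 2) +
      ∫ x in Ω ∩ axial ⁻¹' Ioo (-a - 1) (-a - 1 + 1), ‖fderiv ℝ ψ x‖ ^ 2) := by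
    have hd1 : Disjoint (Ω ∩ axial ⁻¹' Ioo a (a + 1))
        (Ω ∩ axial ⁻¹' Ioo (-a - 1) (-a - 1 + 1)) :=
      Set.disjoint_left.2 fun x hx hx' => by linarith [hx.2.1, hx'.2.2]
    rw [setIntegral_eq_of_subset_of_forall_sdiff_eq_zero hΩ.measurableSet
      (union_subset (inter_subset_left (t := axial ⁻¹' Ioo a (a + 1)))
        (inter_subset_left (t := axial ⁻¹' Ioo (-a - 1) (-a - 1 + 1)))),
      setIntegral_union hd1 (hm _ _) (i2.mono_set inter_subset_left)
        (i2.mono_set inter_subset_left), mul_add]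
    · exact (abs_add_le _ _).trans (add_le_add (hslab a) (hslab (-a - 1)))
    · rintro x ⟨hx, hxu⟩
      have : |axial x| ≤ a ∨ a + 1 ≤ |axial x| := by
        by_contra! hcon
        rcases lt_abs.1 hcon.1 with h1 | h1
        · exact hxu (Or.inl ⟨hx, h1, (le_abs_self _).trans_lt hcon.2⟩)
        · refine hxu (Or.inr ⟨hx, ?_, ?_⟩)
          · linarith [neg_abs_le (axial x)]
          · linarith
      rw [hw, deriv_bump_eq_zero this, zero_mul, zero_mul]
  have hadd := h.energy_add_le hΩ hψ hP ha
  have h1 := neg_le_abs (∫ x in Ω, w (axial x) * ψ x * axial (G x))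
  have h2 : 0 ≤ energy Ω ψ (a + 1) - energy Ω ψ a := by
    have : 0 ≤ ∫ x in Ω ∩ axial ⁻¹' Ioo a (a + 1), ‖fderiv ℝ ψ x‖ ^ 2 :=
      integral_nonneg fun _ => by positivity
    have : 0 ≤ ∫ x in Ω ∩ axial ⁻¹' Ioo (-a - 1) (-a - 1 + 1), ‖fderiv ℝ ψ x‖ ^ 2 :=
      integral_nonneg fun _ => by positivity
    linarith
  have h3 : W * (C + Λ ^ 2) *
      ((∫ x in Ω ∩ axial ⁻¹' Ioo a (a + 1), ‖fderiv ℝ ψ x‖ ^ 2) +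
      ∫ x in Ω ∩ axial ⁻¹' Ioo (-a - 1) (-a - 1 + 1), ‖fderiv ℝ ψ x‖ ^ 2) ≤
      W * (C + Λ ^ 2) * (energy Ω ψ (a + 1) - energy Ω ψ a) := by
    gcongr
    linarith
  linarith

theorem fderiv_eq_zero_of_energy_step (h : IsStraightening Ω α K T S) (hΩ : IsOpen Ω)
    {ψ : Space d → ℝ} (hψ : ContDiffOn ℝ 1 ψ Ω) {P : ℝ} (hP : ∀ x ∈ Ω, ‖fderiv ℝ ψ x‖ ≤ P)
    {l C : ℝ} (hl : 0 < l) (hC : 0 < C)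
    (hstep : ∀ a, 0 ≤ a → l * energy Ω ψ a ≤ C * (energy Ω ψ (a + 1) - energy Ω ψ a)) :
    ∀ x ∈ Ω, fderiv ℝ ψ x = 0 := by
  obtain ⟨V, hV0, hV⟩ := h.exists_volume_slab_le
  have hgrow : ∀ n : ℕ, energy Ω ψ n ≤ (P ^ 2 * V) * (n + 1 : ℕ) ^ (d + 1) := fun n => by
    have h1 : ‖energy Ω ψ n‖ ≤ P ^ 2 * volume.real (Ω ∩ axial ⁻¹' Ioo (-(n : ℝ)) n) := by
      refine norm_setIntegral_le_of_norm_le_const (h.volume_slab_lt_top _ _) fun x hx => ?_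
      rw [Real.norm_eq_abs, abs_of_nonneg (by positivity)]
      gcongr
      exact hP x hx.1
    have h2 : volume.real (Ω ∩ axial ⁻¹' Ioo (-(n : ℝ)) n) ≤ V * (1 + n) ^ (d + 1) :=
      ENNReal.toReal_le_of_le_ofReal (by positivity) (hV n n.cast_nonneg)
    refine (le_abs_self _).trans (h1.trans ?_)
    rw [mul_assoc, Nat.cast_add, Nat.cast_one, add_comm (n : ℝ) 1]
    gcongr
  have hzero := eq_zero_of_growth (fun n => energy_nonneg Ω ψ n) hgrow hl hC
    (fun n => by simpa using hstep n n.cast_nonneg)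
  intro x hx
  obtain ⟨n, hn⟩ := exists_nat_gt |axial x|
  have hopen : IsOpen (Ω ∩ axial ⁻¹' Ioo (-(n : ℝ)) n) :=
    hΩ.inter (isOpen_Ioo.preimage continuous_axial)
  have h0 : (fun x => ‖fderiv ℝ ψ x‖ ^ 2)
      =ᵐ[volume.restrict (Ω ∩ axial ⁻¹' Ioo (-(n : ℝ)) n)] 0 :=
    (integral_eq_zero_iff_of_nonneg (fun _ => by positivity)
      (h.integrableOn_norm_fderiv_sq hΩ hψ hP _ _)).1 (hzero n)
  -- Zero energy gives a zero gradient almost everywhere; continuity on an open set gives it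
  -- everywhere.
  have h1 := Measure.eqOn_open_of_ae_eq h0 hopen
    (((hψ.continuousOn_fderiv_of_isOpen hΩ (by simp)).norm.pow 2).mono inter_subset_left)
    continuousOn_const ⟨hx, abs_lt.1 hn⟩
  simpa using h1

end IsStraightening

/-! ### Uniqueness -/

theorem fderiv_apply_eq_inner_gradient {d : ℕ} (φ : Space d → ℝ) (x v : Space d) :
    fderiv ℝ φ x v = inner ℝ (∇ φ x) v := by
  rw [gradient, InnerProductSpace.toDual_symm_apply]

theorem norm_fderiv_eq_norm_gradient {d : ℕ} (φ : Space d → ℝ) (x : Space d) :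
    ‖fderiv ℝ φ x‖ = ‖∇ φ x‖ := by
  rw [gradient, LinearIsometryEquiv.norm_map]

/-! ### Subsonic flows as weak solutions. -/

namespace IsUniformlySubsonicSolution

variable {d : ℕ} {p : ℝ → ℝ} {B qcr : ℝ} {Ω : Set (Space d)} {φ : Space d → ℝ}

theorem contDiffOn_gradient {ρ : ℝ → ℝ} (h : IsUniformlySubsonicSolution ρ qcr Ω φ)
    (hΩ : IsOpen Ω) : ContDiffOn ℝ 1 (∇ φ) Ω :=
  ((InnerProductSpace.toDual ℝ (Space d)).symm.contDiff).comp_contDiffOn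
    (h.contDiffOn.fderiv_of_isOpen hΩ (by norm_num))

theorem exists_bound {ρ : ℝ → ℝ} (h : IsUniformlySubsonicSolution ρ qcr Ω φ) (hq : 0 < qcr) :
    ∃ Q, 0 ≤ Q ∧ Q < qcr ∧ ∀ x ∈ Ω, ‖∇ φ x‖ ≤ Q := by
  obtain ⟨Q, hQ, H⟩ := h.uniformlySubsonic
  exact ⟨max Q 0, le_max_right _ _, max_lt hQ hq, fun x hx => (H x hx).trans (le_max_left _ _)⟩

theorem contDiffOn_massFluxDensity (h : IsUniformlySubsonicSolution (density p B) qcr Ω φ)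
    (hΩ : IsOpen Ω) (hp : IsEquationOfState p) (hcr : IsCriticalSpeed p B qcr) :
    ContDiffOn ℝ 1 (massFluxDensity (density p B) φ) Ω := by
  obtain ⟨Q, hQ0, hQ, H⟩ := h.exists_bound hcr.1
  refine ContDiffOn.smul ((hcr.contDiffOn_density hp).comp
    ((h.contDiffOn_gradient hΩ).norm_sq ℝ) fun x hx => ?_) (h.contDiffOn_gradient hΩ)
  rw [mem_Iio]
  nlinarith [H x hx, norm_nonneg (∇ φ x)]

theorem exists_norm_massFluxDensity_le (h : IsUniformlySubsonicSolution (density p B) qcr Ω φ)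
    (hp : IsEquationOfState p) (hcr : IsCriticalSpeed p B qcr) :
    ∃ M, ∀ x ∈ Ω, ‖massFluxDensity (density p B) φ x‖ ≤ M := by
  obtain ⟨Q, hQ0, hQ, H⟩ := h.exists_bound hcr.1
  obtain ⟨l, hl, hlip⟩ := hcr.exists_lipschitz hp hQ0 hQ (E := Space d)
  refine ⟨l * Q, fun x hx => ?_⟩
  have := hlip (∇ φ x) 0 (H x hx) (by simpa using hQ0)
  rw [smul_zero, sub_zero, sub_zero] at this
  exact this.trans (by gcongr; exact H x hx)

/-- The mass flux density extends continuously to a field which is tangential on the boundary. -/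
theorem exists_massFluxDensity_extension
    (h : IsUniformlySubsonicSolution (density p B) qcr Ω φ) (hp : IsEquationOfState p)
    (hcr : IsCriticalSpeed p B qcr) :
    ∃ V : Space d → Space d, ContinuousOn V (closure Ω) ∧
      (∀ x ∈ Ω, V x = massFluxDensity (density p B) φ x) ∧
      ∀ x ∈ frontier Ω, ∃ ν, IsOuterUnitNormal Ω x ν ∧ inner ℝ (V x) ν = 0 := by
  obtain ⟨Q, hQ0, hQ, H⟩ := h.exists_bound hcr.1
  obtain ⟨v, hv, hvφ, hn⟩ := h.noFlow
  -- The strict subsonic bound passes to the closure, so the density is evaluated at the boundary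
  -- only where it is known to be regular.
  have hvQ : ∀ x ∈ closure Ω, ‖v x‖ ≤ Q := fun x hx => by
    have h1 : ‖v x‖ ∈ closure ((fun x => ‖v x‖) '' Ω) :=
      hv.norm.image_closure (mem_image_of_mem _ hx)
    refine closure_minimal (t := Iic Q) ?_ isClosed_Iic h1
    rintro _ ⟨z, hz, rfl⟩
    change ‖v z‖ ≤ Q
    rw [hvφ z hz]
    exact H z hz
  refine ⟨fun x => density p B (‖v x‖ ^ 2) • v x, ?_, fun x hx => ?_, fun x hx => ?_⟩
  · refine ((hcr.contDiffOn_density hp).continuousOn.comp (hv.norm.pow 2) fun x hx => ?_).smul hv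
    change ‖v x‖ ^ 2 < qcr ^ 2
    nlinarith [hvQ x hx, norm_nonneg (v x)]
  · simp only [massFluxDensity, hvφ x hx]
  · obtain ⟨ν, hν, h0⟩ := hn x hx
    exact ⟨ν, hν, by rw [real_inner_smul_left, h0, mul_zero]⟩

theorem weak_formulation (h : IsUniformlySubsonicSolution (density p B) qcr Ω φ)
    (hΩ : IsOpen Ω) (hp : IsEquationOfState p) (hcr : IsCriticalSpeed p B qcr) {α K : ℝ}
    {T S : Space d → Space d} (hT : IsStraightening Ω α K T S) {ζ : Space d → ℝ}
    (hζ : ContDiffOn ℝ 1 ζ Ω) {A : ℝ} (hA0 : 0 ≤ A) (hA : ∀ x ∈ Ω, |ζ x| ≤ A)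
    (hA' : ∀ x ∈ Ω, ‖fderiv ℝ ζ x‖ ≤ A) {L : ℝ} (hL : ∀ x ∈ Ω, L ≤ |axial x| → ζ x = 0) :
    IntegrableOn (fun x => fderiv ℝ ζ x (massFluxDensity (density p B) φ x)) Ω ∧
      ∫ x in Ω, fderiv ℝ ζ x (massFluxDensity (density p B) φ x) = 0 := by
  obtain ⟨M, hM⟩ := h.exists_norm_massFluxDensity_le hp hcr
  obtain ⟨V, hV, hVφ, hn⟩ := h.exists_massFluxDensity_extension hp hcr
  refine hT.setIntegral_fderiv_apply_eq_zero hΩ (h.contDiffOn_massFluxDensity hΩ hp hcr)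
    h.equation hM (fun L δ hδ => ?_) hζ hA0 hA hA' hL
  obtain ⟨ε, hε, H⟩ := hT.exists_forall_layer_le hΩ hV hn L hδ
  refine ⟨ε, hε, fun x hx hxL hx1 => ?_⟩
  rw [← hVφ x hx]
  exact H x hx hxL hx1

theorem integrableOn_axial_mul (h : IsUniformlySubsonicSolution (density p B) qcr Ω φ)
    (hΩ : IsOpen Ω) (hp : IsEquationOfState p) (hcr : IsCriticalSpeed p B qcr) {α K : ℝ}
    {T S : Space d → Space d} (hT : IsStraightening Ω α K T S) {w : ℝ → ℝ} (hw : Measurable w)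
    {W : ℝ} (hW : ∀ t, |w t| ≤ W) {L : ℝ} (hL : ∀ t, L ≤ |t| → w t = 0) :
    IntegrableOn (fun x => w (axial x) * axial (massFluxDensity (density p B) φ x)) Ω := by
  obtain ⟨M, hM⟩ := h.exists_norm_massFluxDensity_le hp hcr
  have hW0 : 0 ≤ W := (abs_nonneg _).trans (hW 0)
  refine hT.integrableOn_of_bounded
    (g := fun x => w (axial x) * axial (massFluxDensity (density p B) φ x)) hΩ
    ((hw.comp continuous_axial.measurable).aestronglyMeasurable.mul
      ((continuous_axial.comp_continuousOn
        (h.contDiffOn_massFluxDensity hΩ hp hcr).continuousOn).aestronglyMeasurable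
          hΩ.measurableSet)) (M := W * M) (fun x hx => ?_) (L := L)
    fun x hx hxL => by rw [hL _ hxL, zero_mul]
  rw [abs_mul]
  gcongr
  exacts [hW _, (abs_axial_le_norm _).trans (hM x hx)]

end IsUniformlySubsonicSolution

theorem mainTheorem2 (d : ℕ) (hd : 1 ≤ d)
    (p : ℝ → ℝ) (hp : IsEquationOfState p) (B qcr : ℝ) (hcr : IsCriticalSpeed p B qcr)
    (Ω : Set (Space d)) (hΩ : IsNozzle Ω) (m₀ : ℝ) (φ₁ φ₂ : Space d → ℝ)
    (h₁ : IsUniformlySubsonicSolution (density p B) qcr Ω φ₁)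
    (h₂ : IsUniformlySubsonicSolution (density p B) qcr Ω φ₂)
    (hm₁ : ∀ t : ℝ, massFlux (density p B) Ω φ₁ t = m₀)
    (hm₂ : ∀ t : ℝ, massFlux (density p B) Ω φ₂ t = m₀) :
    ∀ x ∈ Ω, ∇ φ₁ x = ∇ φ₂ x := by
  obtain ⟨hΩo, α, K, -, -, T, S, hT⟩ := hΩ
  obtain ⟨Q₁, hQ₁0, hQ₁, H₁⟩ := h₁.exists_bound hcr.1
  obtain ⟨Q₂, hQ₂0, hQ₂, H₂⟩ := h₂.exists_bound hcr.1
  have hQ0 : 0 ≤ max Q₁ Q₂ := le_max_of_le_left hQ₁0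
  have hQ : max Q₁ Q₂ < qcr := max_lt hQ₁ hQ₂
  -- Both flows share the speed bound max Q₁ Q₂, so a single pair of constants l, Λ serves their
  -- difference.
  obtain ⟨l, hl, hmono⟩ := hcr.exists_monotone hp hQ0 hQ (E := Space d)
  obtain ⟨Λ, hΛ, hlip⟩ := hcr.exists_lipschitz hp hQ0 hQ (E := Space d)
  set F₁ := massFluxDensity (density p B) φ₁ with hF₁
  set F₂ := massFluxDensity (density p B) φ₂ with hF₂
  set ψ : Space d → ℝ := fun x => φ₁ x - φ₂ x with hψdef
  have hψ : ContDiffOn ℝ 1 ψ Ω :=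
    (h₁.contDiffOn.of_le (by norm_num)).sub (h₂.contDiffOn.of_le (by norm_num))
  have hdiff : ∀ {φ : Space d → ℝ}, ContDiffOn ℝ 2 φ Ω → ∀ x ∈ Ω, DifferentiableAt ℝ φ x :=
    fun hφ x hx => (hφ.differentiableOn (by simp)).differentiableAt (hΩo.mem_nhds hx)
  have hgrad : ∀ x ∈ Ω, ∇ ψ x = ∇ φ₁ x - ∇ φ₂ x := fun x hx => by
    simp only [gradient]
    rw [← map_sub, ← fderiv_fun_sub (hdiff h₁.contDiffOn x hx) (hdiff h₂.contDiffOn x hx)]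
  have b₁ : ∀ x ∈ Ω, ‖∇ φ₁ x‖ ≤ max Q₁ Q₂ := fun x hx => (H₁ x hx).trans (le_max_left _ _)
  have b₂ : ∀ x ∈ Ω, ‖∇ φ₂ x‖ ≤ max Q₁ Q₂ := fun x hx => (H₂ x hx).trans (le_max_right _ _)
  have hP : ∀ x ∈ Ω, ‖fderiv ℝ ψ x‖ ≤ max Q₁ Q₂ + max Q₁ Q₂ := fun x hx => by
    rw [norm_fderiv_eq_norm_gradient, hgrad x hx]
    exact (norm_sub_le _ _).trans (add_le_add (b₁ x hx) (b₂ x hx))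
  obtain ⟨C, hC, hstep⟩ := hT.exists_energy_step hΩo hψ hP (G := fun x => F₁ x - F₂ x)
    ((h₁.contDiffOn_massFluxDensity hΩo hp hcr).continuousOn.sub
      (h₂.contDiffOn_massFluxDensity hΩo hp hcr).continuousOn) hl hΛ
    (fun x hx => by
      rw [norm_fderiv_eq_norm_gradient, hgrad x hx]
      exact hlip _ _ (b₁ x hx) (b₂ x hx))
    (fun x hx => by
      rw [norm_fderiv_eq_norm_gradient, fderiv_apply_eq_inner_gradient, hgrad x hx,
        real_inner_comm]
      exact hmono _ _ (b₁ x hx) (b₂ x hx))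
    (fun ζ hζ A hA0 hA hA' L hL => by
      obtain ⟨i₁, e₁⟩ := h₁.weak_formulation hΩo hp hcr hT hζ hA0 hA hA' hL
      obtain ⟨i₂, e₂⟩ := h₂.weak_formulation hΩo hp hcr hT hζ hA0 hA hA' hL
      simp only [map_sub]
      rw [integral_sub i₁ i₂, e₁, e₂, sub_zero])
    (fun w hw W hW L hL => by
      have i₁ := h₁.integrableOn_axial_mul hΩo hp hcr hT hw hW hL
      have i₂ := h₂.integrableOn_axial_mul hΩo hp hcr hT hw hW hL
      have e : ∀ x : Space d, w (axial x) * axial (F₁ x - F₂ x) =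
          w (axial x) * axial (F₁ x) - w (axial x) * axial (F₂ x) := fun x => by
        rw [← mul_sub]
        exact congrArg (w (axial x) * ·) (map_sub (axialL d) (F₁ x) (F₂ x))
      simp_rw [e]
      rw [integral_sub i₁ i₂, setIntegral_axial_mul_massFluxDensity hΩo.measurableSet hm₁ i₁,
        setIntegral_axial_mul_massFluxDensity hΩo.measurableSet hm₂ i₂, sub_self])
  intro x hx
  have h0 := hT.fderiv_eq_zero_of_energy_step hΩo hψ hP hl hC hstep x hx
  rw [← sub_eq_zero, ← hgrad x hx, ← norm_eq_zero, ← norm_fderiv_eq_norm_gradient, h0, norm_zero]
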